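/- **Setting.** An arena $(V,V_0,V_1,E)$ is a finite directed graph $(V,E)$ in which every vertex has a successor, with $V=V_0\uplus V_1$; $V_i$ are the positions of Player $i$. A loop is a non-empty set $C\subseteq V$ such that for all $v,v'\in C$ there is a non-trivial path from $v$ to $v'$ inside $C$. A Muller game $\mathcal G=((V,V_0,V_1,E),\mathcal F_0,\mathcal F_1)$ is given by a set $\mathcal F_0$ of loops, $\mathcal F_1$ being the set of all other loops; Player $i$ wins an infinite play iff the set of vertices visited infinitely often is in $\mathcal F_i$. In a safety game with set $F$ of safe vertices Player $0$ wins a play iff it visits only vertices of $F$. $W_i(\cdot)$ is the set of vertices from which Player $i$ has a winning strategy. A memory structure with set $M$ of states consists of $\mathrm{init}:V\to M$ and $\mathrm{upd}:M\times V\to M$; a finite-state strategy with memory $M$ ($M$ finite) picks the next move as a function of the current vertex and of the current memory state. For $F\subseteq V$ the score $\mathrm{Sc}_F(w)\in\mathbb N$ and the accumulator $\mathrm{Acc}_F(w)\subseteq F$ of a non-empty word $w$ over $V$ are defined as follows: $\mathrm{Sc}_{\{v\}}(v)=1$, $\mathrm{Acc}_{\{v\}}(v)=\emptyset$; $\mathrm{Sc}_F(v)=0$,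 $\mathrm{Acc}_F(v)=F\cap\{v\}$ if $F\neq\{v\}$; if $v\notin F$ then $\mathrm{Sc}_F(wv)=0$, $\mathrm{Acc}_F(wv)=\emptyset$; if $v\in F$ and $\mathrm{Acc}_F(w)=F\setminus\{v\}$ then $\mathrm{Sc}_F(wv)=\mathrm{Sc}_F(w)+1$, $\mathrm{Acc}_F(wv)=\emptyset$; otherwise $\mathrm{Sc}_F(wv)=\mathrm{Sc}_F(w)$, $\mathrm{Acc}_F(wv)=\mathrm{Acc}_F(w)\cup\{v\}$. Write $w=_{\mathcal F_1}w'$ if $w,w'$ have the same last vertex and the same scores and accumulators for all $F\in\mathcal F_1$. Let $P_{<3}$ be the set of play prefixes (non-empty finite paths) all of whose non-empty prefixes have scores at most $2$ for every $F\in\mathcal F_1$, let $P_{=3}$ be the set of play prefixes $wv$ with $w \in P_{<3}$ and $\mathrm{Sc}_F(wv)=3$ for some $F\in\mathcal F_1$, and $P_{\le3}=P_{<3}\cup P_{=3}$. **The safety game.** The vertices of $\mathcal G_S$ are the $=_{\mathcal F_1}$-classes $[w]$ of $w\in P_{\le 3}$; $[w]$ belongs to the player who owns the last vertex of $w$; there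 is an edge from $[w]$ to $[wv]$ for all $w\in P_{<3}$ and all successors $v$ of the last vertex of $w$, and a self-loop at each class of elements of $P_{=3}$; the safe vertices are the classes of elements of $P_{<3}$. Let $f(v)=[v]$ for $v\in V$. The merged game $\mathcal G_S^{m}$ is defined in the same way, except that all elements of $P_{=3}$ form one single class (whose owner is irrelevant). **Theorem.** Both safety games are finite and, together with $f$, effectively constructible: there are computable functions that map every finite code of a Muller game $\mathcal G$ to a code of $\mathcal G_S$ (respectively $\mathcal G_S^m$) and of $f$. Moreover, for every Muller game $\mathcal G$ with vertex set $V$, and for $\mathcal S=\mathcal G_S$ as well as for $\mathcal S=\mathcal G_S^m$: 1. For all $v\in V$ and $i\in\{0,1\}$: $v\in W_i(\mathcal G)$ if and only if $f(v)\in W_i(\mathcal S)$. 2. If $W_0(\mathcal G)\neq\emptyset$, then Player $0$ has a finite-state strategy with some memory $M\subseteq W_0(\mathcal S)$ that is winning from every vertex of $W_0(\mathcal G)$. 3. The vertex set $V^S$ of $\mathcal G_S^m$ satisfies $$|V^S|\le\Big(\sum_{k=1}^{|V|}\binom{|V|}{k}\cdot k!\cdot 2^k\cdot k!\Big)+1,$$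 and if $|V|\ge4$, then the right-hand side is at most $(|V|!)^3$. -/

import Mathlib

namespace MullerGames

open scoped Classical

/-! # Arenas, games, strategies -/

/-- An arena on the vertex set `V`: the positions of Player 0, the edge relation, and the requirement
that no vertex is terminal. Finiteness of `V` is assumed (or claimed) where arenas are used. -/
structure Arena (V : Type*) where
  pos0 : Set V
  Adj : V → V → Prop
  serial : ∀ v, ∃ v', Adj v v'

/-- The positions of Player `i`; those of Player 1 are the vertices that are not Player 0's. -/
def Arena.pos {V : Type*} (A : Arena V) (i : Fin 2) : Set V :=
  if i = 0 then A.pos0 else A.pos0ᶜ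

/-- A set `C` of vertices is a loop if it is non-empty and any `v, v' ∈ C` are joined by a
(non-trivial) path of the arena that visits only vertices of `C`. -/
def Arena.IsLoop {V : Type*} (A : Arena V) (C : Set V) : Prop :=
  C.Nonempty ∧ ∀ v ∈ C, ∀ v' ∈ C,
    Relation.TransGen (fun a b => a ∈ C ∧ b ∈ C ∧ A.Adj a b) v v'

/-- Infinite plays starting in `v`. -/
def Arena.IsPlayFrom {V : Type*} (A : Arena V) (v : V) (ρ : ℕ → V) : Prop :=
  ρ 0 = v ∧ ∀ n, A.Adj (ρ n) (ρ (n + 1))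

/-- Play prefixes: finite non-empty paths of the arena (there are no terminal vertices, so
these are exactly the non-empty finite prefixes of plays). -/
def Arena.IsPlayPrefix {V : Type*} (A : Arena V) (w : List V) : Prop :=
  w ≠ [] ∧ w.IsChain A.Adj

/-- A strategy for Player `i`: a map `σ : V^* V_i → V`, with `σ (w v)` written `move w v`,
that chooses a successor of the last vertex. -/
structure Strategy {V : Type*} (A : Arena V) (i : Fin 2) where
  move : List V → A.pos i → V
  adj : ∀ (w : List V) (v : A.pos i), A.Adj v (move w v)

/-- The play `ρ` is consistent with `σ`; the history before time `n` is `ρ 0 ⋯ ρ (n - 1)`. -/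
def Strategy.Consistent {V : Type*} {A : Arena V} {i : Fin 2} (σ : Strategy A i)
    (ρ : ℕ → V) : Prop :=
  ∀ n (h : ρ n ∈ A.pos i), ρ (n + 1) = σ.move ((List.range n).map ρ) ⟨ρ n, h⟩

/-- The plays that start in `v` and are consistent with `σ`. -/
def Strategy.Beh {V : Type*} {A : Arena V} {i : Fin 2} (σ : Strategy A i) (v : V) :
    Set (ℕ → V) :=
  {ρ | A.IsPlayFrom v ρ ∧ σ.Consistent ρ}

/-- A game: an arena and the set of plays won by Player 0. -/
structure Game (V : Type*) where
  arena : Arena V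
  win : Set (ℕ → V)

/-- `ρ` is won by Player `i`. -/
def Game.WonBy {V : Type*} (G : Game V) (i : Fin 2) (ρ : ℕ → V) : Prop :=
  if i = 0 then ρ ∈ G.win else ρ ∉ G.win

/-- `σ` is a winning strategy for Player `i` from the set `W`. -/
def Game.IsWinningFrom {V : Type*} (G : Game V) {i : Fin 2} (σ : Strategy G.arena i)
    (W : Set V) : Prop :=
  ∀ v ∈ W, ∀ ρ ∈ σ.Beh v, G.WonBy i ρ

/-- The winning region of Player `i`. -/
def Game.winRegion {V : Type*} (G : Game V) (i : Fin 2) : Set V :=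
  {v | ∃ σ : Strategy G.arena i, G.IsWinningFrom σ {v}}

/-! # Memory structures -/

/-- A memory structure with set `M` of memory states. -/
structure MemoryStructure (V M : Type*) where
  init : V → M
  update : M → V → M

/-- `updateStar w v` is the memory state after the non-empty word `w v`. -/
def MemoryStructure.updateStar {V M : Type*} (𝔐 : MemoryStructure V M) : List V → V → M
  | [], v => 𝔐.init v
  | x :: w, v => (w ++ [v]).foldl 𝔐.update (𝔐.init x)

/-- A next-move function for Player `i`. -/
structure NextMove {V : Type*} (A : Arena V) (i : Fin 2) (M : Type*) where
  next : A.pos i → M → V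
  adj : ∀ (v : A.pos i) (m : M), A.Adj v (next v m)

/-- The strategy implemented by a memory structure and a next-move function. -/
def NextMove.strategy {V M : Type*} {A : Arena V} {i : Fin 2} (nxt : NextMove A i M)
    (𝔐 : MemoryStructure V M) : Strategy A i where
  move w v := nxt.next v (𝔐.updateStar w v)
  adj _ v := nxt.adj v _

/-! # Safety games and Muller games -/

/-- A safety game: an arena and the set of safe vertices. -/
structure SafetyGame (V : Type*) where
  arena : Arena V
  safe : Set V

/-- Player 0 wins a play of a safety game if all its vertices are safe. -/
def SafetyGame.toGame {V : Type*} (S : SafetyGame V) : Game V where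
  arena := S.arena
  win := {ρ | Set.range ρ ⊆ S.safe}

/-- The set of vertices visited infinitely often. -/
def infi {V : Type*} (ρ : ℕ → V) : Set V :=
  {v | ∃ᶠ n in Filter.atTop, ρ n = v}

/-- A Muller game: an arena and a set `F0` of loops. -/
structure MullerGame (V : Type*) where
  arena : Arena V
  F0 : Set (Set V)
  isLoop_of_mem : ∀ F ∈ F0, arena.IsLoop F

/-- The loops that are not in `F0`. -/
def MullerGame.F1 {V : Type*} (G : MullerGame V) : Set (Set V) :=
  {F | G.arena.IsLoop F ∧ F ∉ G.F0}

/-- Player 0 wins a play of a Muller game if its infinity set is in `F0`. -/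
def MullerGame.toGame {V : Type*} (G : MullerGame V) : Game V where
  arena := G.arena
  win := {ρ | infi ρ ∈ G.F0}

/-! # Scores and accumulators -/

/-- How score and accumulator of `F` change when the vertex `v` is visited. -/
noncomputable def scoreStep {V : Type*} (F : Set V) (p : ℕ × Set V) (v : V) : ℕ × Set V :=
  if v ∉ F then (0, ∅)
  else if p.2 = F \ {v} then (p.1 + 1, ∅)
  else (p.1, p.2 ∪ {v})

/-- Score and accumulator of `F` for the word `w`. The value `(0, ∅)` for the empty word
is only a convention that makes the recursion uniform, see `score_singleton_self` and the
lemmas following it. -/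
noncomputable def scoreAcc {V : Type*} (F : Set V) (w : List V) : ℕ × Set V :=
  w.foldl (scoreStep F) (0, ∅)

noncomputable def score {V : Type*} (F : Set V) (w : List V) : ℕ := (scoreAcc F w).1

noncomputable def acc {V : Type*} (F : Set V) (w : List V) : Set V := (scoreAcc F w).2

theorem scoreAcc_concat {V : Type*} (F : Set V) (w : List V) (v : V) :
    scoreAcc F (w ++ [v]) = scoreStep F (scoreAcc F w) v := by
  simp [scoreAcc, List.foldl_append]

theorem score_singleton_self {V : Type*} (v : V) : score {v} [v] = 1 ∧ acc {v} [v] = ∅ := by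
  simp [score, acc, scoreAcc, scoreStep]

theorem score_singleton_ne {V : Type*} (F : Set V) (v : V) (h : F ≠ {v}) :
    score F [v] = 0 ∧ acc F [v] = F ∩ {v} := by
  by_cases hv : v ∈ F
  · have h1 : ¬ (∅ = F \ {v}) := by
      intro h2
      exact h (Set.Subset.antisymm (Set.sdiff_eq_empty.mp h2.symm) (by simpa using hv))
    simp [score, acc, scoreAcc, scoreStep, hv, h1]
  · simp [score, acc, scoreAcc, scoreStep, hv]

theorem score_concat_of_notMem {V : Type*} (F : Set V) (w : List V) (v : V) (hv : v ∉ F) :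
    score F (w ++ [v]) = 0 ∧ acc F (w ++ [v]) = ∅ := by
  simp [score, acc, scoreAcc_concat, scoreStep, hv]

theorem score_concat_of_acc_eq {V : Type*} (F : Set V) (w : List V) (v : V) (hv : v ∈ F)
    (h : acc F w = F \ {v}) :
    score F (w ++ [v]) = score F w + 1 ∧ acc F (w ++ [v]) = ∅ := by
  unfold acc at h
  simp [score, acc, scoreAcc_concat, scoreStep, hv, h]

theorem score_concat_of_acc_ne {V : Type*} (F : Set V) (w : List V) (v : V) (hv : v ∈ F)
    (h : acc F w ≠ F \ {v}) :
    score F (w ++ [v]) = score F w ∧ acc F (w ++ [v]) = acc F w ∪ {v} := by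
  unfold acc at h
  simp [score, acc, scoreAcc_concat, scoreStep, hv, h]

theorem score_concat_le {V : Type*} (F : Set V) (w : List V) (v : V) :
    score F (w ++ [v]) ≤ score F w + 1 := by
  unfold score
  rw [scoreAcc_concat]
  unfold scoreStep
  split_ifs <;> simp

/-- The maximal score of a set in `Fs` on a non-empty prefix of `w`. -/
noncomputable def maxScore {V : Type*} (Fs : Set (Set V)) (w : List V) : ℕ∞ :=
  ⨆ F ∈ Fs, ⨆ u ∈ {u : List V | u ≠ [] ∧ u <+: w}, (score F u : ℕ∞)

theorem maxScore_le_iff {V : Type*} (Fs : Set (Set V)) (w : List V) (k : ℕ) :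
    maxScore Fs w ≤ k ↔ ∀ F ∈ Fs, ∀ u, u ≠ [] → u <+: w → score F u ≤ k := by
  simp [maxScore, iSup_le_iff]

theorem maxScore_concat_le {V : Type*} (Fs : Set (Set V)) (w : List V) (v : V) (k : ℕ)
    (h : maxScore Fs w ≤ k) : maxScore Fs (w ++ [v]) ≤ (k + 1 : ℕ) := by
  rw [maxScore_le_iff] at h ⊢
  intro F hF u hu hp
  rcases List.prefix_concat_iff.mp hp with rfl | hp
  · rcases List.eq_nil_or_concat w with rfl | ⟨w', x, hw⟩
    · have := score_concat_le F [] v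
      have h0 : score F ([] : List V) = 0 := rfl
      omega
    · have h1 := score_concat_le F w v
      have h2 := h F hF w (by simp [hw]) List.prefix_rfl
      exact h1.trans (by omega)
  · exact (h F hF u hu hp).trans (Nat.le_succ k)

theorem enat_lt_three_iff (a : ℕ∞) : a < 3 ↔ a ≤ (2 : ℕ) := by
  have h : (3 : ℕ∞) = (2 : ℕ) + 1 := by norm_num
  rw [h]
  exact ENat.lt_add_one_iff (by simp)

/-- `w` is `Fs`-smaller than `w'`. -/
def Smaller {V : Type*} (Fs : Set (Set V)) (w w' : List V) : Prop :=
  w.getLast? = w'.getLast? ∧ ∀ F ∈ Fs,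
    score F w < score F w' ∨ (score F w = score F w' ∧ acc F w ⊆ acc F w')

/-- `w` and `w'` are `Fs`-equivalent. -/
def Equivalent {V : Type*} (Fs : Set (Set V)) (w w' : List V) : Prop :=
  Smaller Fs w w' ∧ Smaller Fs w' w

theorem Smaller.refl {V : Type*} (Fs : Set (Set V)) (w : List V) : Smaller Fs w w :=
  ⟨rfl, fun _ _ => Or.inr ⟨rfl, subset_rfl⟩⟩

theorem Smaller.trans {V : Type*} {Fs : Set (Set V)} {w₁ w₂ w₃ : List V}
    (h : Smaller Fs w₁ w₂) (h' : Smaller Fs w₂ w₃) : Smaller Fs w₁ w₃ := by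
  refine ⟨h.1.trans h'.1, fun F hF => ?_⟩
  rcases h.2 F hF with a | ⟨a, b⟩ <;> rcases h'.2 F hF with c | ⟨c, d⟩
  · exact Or.inl (a.trans c)
  · exact Or.inl (c ▸ a)
  · exact Or.inl (a ▸ c)
  · exact Or.inr ⟨a.trans c, b.trans d⟩

/-! # The safety game of a Muller game -/

/-- The play prefixes on which all scores of Player 1 stay below 3. -/
def playsLt3 {V : Type*} (G : MullerGame V) : Set (List V) :=
  {w | G.arena.IsPlayPrefix w ∧ maxScore G.F1 w < 3}

/-- The play prefixes at whose end Player 1 reaches the score 3 for the first time. -/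
def playsEq3 {V : Type*} (G : MullerGame V) : Set (List V) :=
  {w | G.arena.IsPlayPrefix w ∧ ∃ u v, u ≠ [] ∧ w = u ++ [v] ∧
    maxScore G.F1 u ≤ 2 ∧ maxScore G.F1 w = 3}

def playsLe3 {V : Type*} (G : MullerGame V) : Set (List V) := playsLt3 G ∪ playsEq3 G

theorem singleton_mem_playsLt3 {V : Type*} (G : MullerGame V) (v : V) : [v] ∈ playsLt3 G := by
  refine ⟨⟨by simp, by simp⟩, ?_⟩
  rw [enat_lt_three_iff]
  have h0 : maxScore G.F1 ([] : List V) ≤ (0 : ℕ) := by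
    rw [maxScore_le_iff]
    intro F _ u hu hp
    exact absurd (List.prefix_nil.mp hp) hu
  have h := maxScore_concat_le G.F1 [] v 0 h0
  exact h.trans (by norm_num)

theorem concat_mem_playsLe3 {V : Type*} (G : MullerGame V) {w : List V} {x v : V}
    (hw : w ∈ playsLt3 G) (hx : x ∈ w.getLast?) (hv : G.arena.Adj x v) :
    w ++ [v] ∈ playsLe3 G := by
  have hp : G.arena.IsPlayPrefix (w ++ [v]) := by
    refine ⟨by simp, ?_⟩
    rw [List.isChain_append]
    refine ⟨hw.1.2, by simp, ?_⟩
    intro y hy z hz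
    simp only [List.head?_cons, Option.mem_some_iff] at hz
    subst hz
    rw [Option.mem_unique hy hx]
    exact hv
  have h2 : maxScore G.F1 w ≤ (2 : ℕ) := (enat_lt_three_iff _).mp hw.2
  have h3 := maxScore_concat_le G.F1 w v 2 h2
  rcases lt_or_ge (maxScore G.F1 (w ++ [v])) 3 with h | h
  · exact Or.inl ⟨hp, h⟩
  · exact Or.inr ⟨hp, w, v, hw.1.1, rfl, h2, le_antisymm h3 h⟩

theorem playsEq3_of_equivalent {V : Type*} (G : MullerGame V) {w w' : List V}
    (hw : w ∈ playsEq3 G) (hw' : w' ∈ playsLe3 G) (h : Smaller G.F1 w w') :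
    w' ∈ playsEq3 G := by
  rcases hw' with hw' | hw'
  · exfalso
    obtain ⟨-, u, v, hu, rfl, h2, h3⟩ := hw
    have hlt := (maxScore_le_iff _ _ _).mp ((enat_lt_three_iff _).mp hw'.2)
    have h2' := (maxScore_le_iff _ _ 2).mp h2
    have : maxScore G.F1 (u ++ [v]) ≤ (2 : ℕ) := by
      rw [maxScore_le_iff]
      intro F hF t ht hp
      rcases List.prefix_concat_iff.mp hp with rfl | hp
      · have a := hlt F hF w' hw'.1.1 List.prefix_rfl
        rcases h.2 F hF with b | ⟨b, -⟩ <;> omega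
      · exact h2' F hF t ht hp
    rw [← enat_lt_three_iff, h3] at this
    exact lt_irrefl _ this
  · exact hw'

/-- The equivalence relation on `playsLe3 G` whose classes are the vertices of the safety game.
For `merge = false` it is `F1`-equivalence. For `merge = true` it is `F1`-equivalence on
`playsLt3 G`, and all of `playsEq3 G` (the losing vertices of the safety game) is
one class. -/
def vertexSetoid {V : Type*} (G : MullerGame V) (merge : Bool) : Setoid (playsLe3 G) where
  r w w' := Equivalent G.F1 w.1 w'.1 ∨ (merge = true ∧ w.1 ∈ playsEq3 G ∧ w'.1 ∈ playsEq3 G)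
  iseqv :=
    { refl := fun w => Or.inl ⟨Smaller.refl _ _, Smaller.refl _ _⟩
      symm := by
        rintro w w' (h | ⟨h, a, b⟩)
        · exact Or.inl ⟨h.2, h.1⟩
        · exact Or.inr ⟨h, b, a⟩
      trans := by
        rintro w₁ w₂ w₃ (h | ⟨h, a, b⟩) (h' | ⟨h', a', b'⟩)
        · exact Or.inl ⟨h.1.trans h'.1, h'.2.trans h.2⟩
        · exact Or.inr ⟨h', playsEq3_of_equivalent G a' w₁.2 h.2, b'⟩
        · exact Or.inr ⟨h, a, playsEq3_of_equivalent G b w₃.2 h'.1⟩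
        · exact Or.inr ⟨h, a, b'⟩ }

/-- The vertex set of the safety game. -/
def SafetyVertex {V : Type*} (G : MullerGame V) (merge : Bool) : Type _ :=
  Quotient (vertexSetoid G merge)

/-- The class of a play prefix. -/
def cls {V : Type*} (G : MullerGame V) (merge : Bool) (w : playsLe3 G) :
    SafetyVertex G merge :=
  Quotient.mk (vertexSetoid G merge) w

/-- The classes of the play prefixes on which Player 1's scores stay below 3. -/
def safeVertices {V : Type*} (G : MullerGame V) (merge : Bool) : Set (SafetyVertex G merge) :=
  {q | ∃ w : playsLe3 G, w.1 ∈ playsLt3 G ∧ cls G merge w = q}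

/-- The arena of the safety game. A class belongs to the player who owns the last vertex (for
the one merged losing vertex the owner is irrelevant). The edges lead from the class of
`w ∈ playsLt3 G` to the class of `w v`, for each successor `v` of the last vertex of `w`. The
vertices that are not safe get a self-loop, as arenas have no terminal vertices. -/
def safetyArena {V : Type*} (G : MullerGame V) (merge : Bool) :
    Arena (SafetyVertex G merge) where
  pos0 := {q | ∃ w : playsLe3 G, cls G merge w = q ∧ ∃ v ∈ w.1.getLast?, v ∈ G.arena.pos0}
  Adj q q' :=
    (∃ w w' : playsLe3 G, w.1 ∈ playsLt3 G ∧
      (∃ x ∈ w.1.getLast?, ∃ v, G.arena.Adj x v ∧ w'.1 = w.1 ++ [v]) ∧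
      cls G merge w = q ∧ cls G merge w' = q') ∨
    (q ∉ safeVertices G merge ∧ q' = q)
  serial := by
    intro q
    by_cases hq : q ∈ safeVertices G merge
    · obtain ⟨w, hw, rfl⟩ := hq
      have hx : w.1.getLast hw.1.1 ∈ w.1.getLast? := List.getLast?_eq_some_getLast hw.1.1
      obtain ⟨v, hv⟩ := G.arena.serial (w.1.getLast hw.1.1)
      exact ⟨cls G merge ⟨w.1 ++ [v], concat_mem_playsLe3 G hw hx hv⟩, Or.inl
        ⟨w, ⟨w.1 ++ [v], concat_mem_playsLe3 G hw hx hv⟩, hw, ⟨_, hx, v, hv, rfl⟩, rfl, rfl⟩⟩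
    · exact ⟨q, Or.inr ⟨hq, rfl⟩⟩

/-- The safety game of a Muller game. -/
def safetyGame {V : Type*} (G : MullerGame V) (merge : Bool) :
    SafetyGame (SafetyVertex G merge) where
  arena := safetyArena G merge
  safe := safeVertices G merge

/-- The map `v ↦ [v]` from the vertices of the Muller game to those of the safety game. -/
def toSafety {V : Type*} (G : MullerGame V) (merge : Bool) (v : V) : SafetyVertex G merge :=
  cls G merge ⟨[v], Or.inl (singleton_mem_playsLt3 G v)⟩

/-! # Finite codes of games, as inputs and outputs of algorithms -/

/-- Codes of Muller games: number `n` of vertices, list of Player 0's vertices, list of edges,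
list of the sets in `F0`. The vertices are numbered `0, …, n - 1`. -/
abbrev MullerCode : Type := ℕ × List ℕ × List (ℕ × ℕ) × List (List ℕ)

/-- Codes of safety games: number of vertices, list of Player 0's vertices, list of edges, list of
the safe vertices. -/
abbrev SafetyCode : Type := ℕ × List ℕ × List (ℕ × ℕ) × List ℕ

/-- The code describes the arena `A` when the vertices are numbered by `e`. -/
def Arena.CodedBy {V : Type*} (A : Arena V) {n : ℕ} (e : V ≃ Fin n) (pos0 : List ℕ)
    (edges : List (ℕ × ℕ)) : Prop :=
  (∀ v, v ∈ A.pos0 ↔ (e v : ℕ) ∈ pos0) ∧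
    ∀ v v', A.Adj v v' ↔ ((e v : ℕ), (e v' : ℕ)) ∈ edges

/-- `c` is a code of `G` when the vertices are numbered by `e`. -/
def MullerGame.CodedBy {V : Type*} (G : MullerGame V) (c : MullerCode) (e : V ≃ Fin c.1) :
    Prop :=
  G.arena.CodedBy e c.2.1 c.2.2.1 ∧
    G.F0 = {F | ∃ l ∈ c.2.2.2, F = {v | (e v : ℕ) ∈ l}}

/-- `c` is a code of `S` when the vertices are numbered by `e`. -/
def SafetyGame.CodedBy {V : Type*} (S : SafetyGame V) (c : SafetyCode) (e : V ≃ Fin c.1) :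
    Prop :=
  S.arena.CodedBy e c.2.1 c.2.2.1 ∧ ∀ v, v ∈ S.safe ↔ (e v : ℕ) ∈ c.2.2.2

end MullerGames

/-!
The heart of the matter is that, from every vertex, one of the two players can move in such a way
that all scores of the opponent stay at most 2 (`canBound_or_canBound`). Bounded scores of `F`
exclude `F` as infinity set (`infi_ne_of_score_le`), so this gives the determinacy of Muller games.
It also says that Player 0 wins the safety game from `[v]` whenever she wins the Muller game from
`v`: the classes of the histories that can occur form a set of safe vertices that Player 1 cannot
leave (`toSafety_mem_winRegion_of_canBound`). Conversely, the winning region of Player 0 in the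
safety game is such a set, and its elements, the classes of the current play prefixes, are the
memory states of a strategy for the Muller game that keeps the scores of Player 1 below 3
(`exists_finiteState_strategy`). Since safety games are determined as well, the winning regions of
Player 1 correspond to each other, too.

The bound on the scores is proved by induction on the subarena `A`, along Zielonka's recursion
(`splits_of_serial`). The hypothesis that makes the induction work concerns the history with which
`A` is entered: every relevant set has score 0, or score 1 and an empty accumulator (`LowScores`).
Let `A` be good for the player. If the recursion gives the whole of each subarena outside the
attractor of `A \ C` to the player, for the sets `C` of the opponent, then the player plays in
phases (`bounding_of_forall_inner`). Each phase is directed against a set `C` that contains all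
current accumulators and all sets of positive score; it exists because these sets are linearly
ordered, being the sets of vertices of suffixes of the history. A phase ends when `A \ C` is
reached, and then the scores are low again; in between no score exceeds 2, since the sets inside the
subarena are bounded by recursion and every other set is completed at most twice. If the recursion
gives a part `X` of one of these subarenas to the opponent, then the opponent attracts to `X`, stays
in `X`, and the rest of the arena is treated recursively (`bounding_union_attractor`).

For the number of classes: the scores and accumulators of a word are determined by the order of the
last occurrences of its vertices, except for the sets that consist of the `j` vertices visited last,
which have one of 2 scores and one of `j` accumulators (`equivalent_of_dedup_eq`).

For computability, the classes are coded by lists of scores and accumulators. Loops and reachable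
codes are both defined by quantification over the closed subsets of a finite list, so that no
search and no bound on the number of iterations is needed; the algorithm is primitive recursive
(`primrec_reduction`, `reduction_correct`).
-/

namespace MullerGames

/-! ### Scores, accumulators and suffixes -/

theorem score_concat_cases {V : Type*} (F : Set V) (w : List V) (v : V) :
    (v ∉ F ∧ score F (w ++ [v]) = 0 ∧ acc F (w ++ [v]) = ∅) ∨
    (v ∈ F ∧ acc F w = F \ {v} ∧ score F (w ++ [v]) = score F w + 1 ∧ acc F (w ++ [v]) = ∅) ∨
    (v ∈ F ∧ acc F w ≠ F \ {v} ∧ score F (w ++ [v]) = score F w ∧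
      acc F (w ++ [v]) = acc F w ∪ {v}) := by
  by_cases hv : v ∈ F
  · by_cases h : acc F w = F \ {v}
    · exact Or.inr (Or.inl ⟨hv, h, score_concat_of_acc_eq F w v hv h⟩)
    · exact Or.inr (Or.inr ⟨hv, h, score_concat_of_acc_ne F w v hv h⟩)
  · exact Or.inl ⟨hv, score_concat_of_notMem F w v hv⟩

theorem score_nil {V : Type*} (F : Set V) : score F ([] : List V) = 0 := rfl

theorem acc_nil {V : Type*} (F : Set V) : acc F ([] : List V) = ∅ := rfl

theorem acc_subset {V : Type*} (F : Set V) (w : List V) : acc F w ⊆ F := by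
  induction w using List.reverseRecOn with
  | nil => simp [acc_nil]
  | append_singleton w v ih =>
    rcases score_concat_cases F w v with ⟨-, -, h⟩ | ⟨-, -, -, h⟩ | ⟨hv, -, -, h⟩ <;> rw [h]
    · exact Set.empty_subset _
    · exact Set.empty_subset _
    · exact Set.union_subset ih (Set.singleton_subset_iff.mpr hv)

theorem acc_ne_self {V : Type*} {F : Set V} (hF : F.Nonempty) (w : List V) : acc F w ≠ F := by
  induction w using List.reverseRecOn with
  | nil => exact fun h => hF.ne_empty h.symm
  | append_singleton w v ih =>
    rcases score_concat_cases F w v with ⟨-, -, h⟩ | ⟨-, -, -, h⟩ | ⟨hv, hne, -, h⟩ <;> rw [h]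
    · exact fun h => hF.ne_empty h.symm
    · exact fun h => hF.ne_empty h.symm
    · intro hu
      by_cases hva : v ∈ acc F w
      · exact ih (by rwa [Set.union_eq_left.mpr (Set.singleton_subset_iff.mpr hva)] at hu)
      · suffices key : acc F w = (acc F w ∪ {v}) \ {v} by rw [hu] at key; exact hne key
        ext a
        simp only [Set.mem_sdiff, Set.mem_union, Set.mem_singleton_iff]
        constructor
        · exact fun ha => ⟨Or.inl ha, fun hav => hva (hav ▸ ha)⟩
        · rintro ⟨ha | ha, hn⟩
          · exact ha
          · exact absurd ha hn

theorem mem_of_score_pos {V : Type*} {F : Set V} {w : List V} {x : V}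
    (h : 0 < score F (w ++ [x])) : x ∈ F := by
  by_contra hx
  have := (score_concat_of_notMem F w x hx).1
  omega

/-- The accumulator collects the vertices of a suffix of the word. -/
theorem exists_suffix_acc {V : Type*} (F : Set V) (w : List V) :
    ∃ x, x <:+ w ∧ acc F w = {a | a ∈ x} := by
  induction w using List.reverseRecOn with
  | nil => exact ⟨[], List.suffix_rfl, by simp [acc_nil]⟩
  | append_singleton w v ih =>
    rcases score_concat_cases F w v with ⟨-, -, h⟩ | ⟨-, -, -, h⟩ | ⟨hv, -, -, h⟩
    · exact ⟨[], List.nil_suffix, by simp [h]⟩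
    · exact ⟨[], List.nil_suffix, by simp [h]⟩
    · obtain ⟨x, ⟨y, rfl⟩, hx⟩ := ih
      refine ⟨x ++ [v], ⟨y, by simp⟩, ?_⟩
      rw [h, hx]
      ext a
      simp [or_comm]

/-- A set with positive score is the set of vertices of a suffix of the word. -/
theorem exists_suffix_of_score_pos {V : Type*} (F : Set V) (w : List V) (hs : 0 < score F w) :
    ∃ x, x <:+ w ∧ F = {a | a ∈ x} := by
  induction w using List.reverseRecOn with
  | nil => simp [score_nil] at hs
  | append_singleton w v ih =>
    rcases score_concat_cases F w v with ⟨-, h, -⟩ | ⟨hv, ha, -, -⟩ | ⟨hv, -, h, -⟩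
    · omega
    · obtain ⟨x, ⟨y, rfl⟩, hx⟩ := exists_suffix_acc F w
      refine ⟨x ++ [v], ⟨y, by simp⟩, ?_⟩
      ext a
      have : a ∈ acc F (y ++ x) ↔ a ∈ x := by rw [hx]; rfl
      rw [ha] at this
      simp only [Set.mem_sdiff, Set.mem_singleton_iff] at this
      simp only [List.mem_append, List.mem_singleton, Set.mem_ofPred_eq, ← this]
      constructor
      · intro h; by_cases hav : a = v <;> simp [hav, h]
      · rintro (h | h)
        · exact h.1
        · exact h ▸ hv
    · obtain ⟨x, ⟨y, rfl⟩, hx⟩ := ih (by omega)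
      refine ⟨x ++ [v], ⟨y, by simp⟩, ?_⟩
      ext a
      simp only [List.mem_append, List.mem_singleton, Set.mem_ofPred_eq]
      rw [hx] at hv
      constructor
      · intro h; rw [hx] at h; exact Or.inl h
      · rintro (h | h)
        · rw [hx]; exact h
        · rw [hx, h]; exact hv

/-- Scores and accumulators are linearly ordered: among the sets of a family there is one that
contains all accumulators and all sets of positive score. -/
theorem exists_mem_forall_acc_subset {V : Type*} (Fs : Set (Set V)) (hFs : Fs.Nonempty)
    (w : List V) :
    ∃ C ∈ Fs, ∀ F ∈ Fs, acc F w ⊆ C ∧ (0 < score F w → F ⊆ C) := by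
  have key : ∀ F : Set V, ∃ x, x <:+ w ∧ {a | a ∈ x} ⊆ F ∧ acc F w ⊆ {a | a ∈ x} ∧
      (0 < score F w → F ⊆ {a | a ∈ x}) := by
    intro F
    by_cases hs : 0 < score F w
    · obtain ⟨x, hx, h⟩ := exists_suffix_of_score_pos F w hs
      exact ⟨x, hx, h.ge, (acc_subset F w).trans h.le, fun _ => h.le⟩
    · obtain ⟨x, hx, h⟩ := exists_suffix_acc F w
      exact ⟨x, hx, h.ge.trans (acc_subset F w), h.le, fun h => absurd h hs⟩
  choose x hx hxF hacc hsc using key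
  -- a member of `Fs` with a longest such suffix
  obtain ⟨C, hC, hmin⟩ : ∃ C ∈ Fs, ∀ F ∈ Fs, (x F).length ≤ (x C).length := by
    obtain ⟨C, hC, hmin⟩ := exists_minimalFor_of_wellFoundedLT (fun F => F ∈ Fs)
      (fun F => w.length - (x F).length) hFs
    refine ⟨C, hC, fun F hF => ?_⟩
    have h1 := (hx F).length_le
    have h2 := (hx C).length_le
    by_contra hlt
    have := hmin hF (by dsimp only; omega)
    dsimp only at this
    omega
  refine ⟨C, hC, fun F hF => ?_⟩
  have hsub : {a | a ∈ x F} ⊆ C := by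
    have := List.suffix_of_suffix_length_le (hx F) (hx C) (hmin F hF)
    exact fun a ha => hxF C (this.subset ha)
  exact ⟨(hacc F).trans hsub, fun h => (hsc F h).trans hsub⟩

/-! ### Infinity sets and bounded scores -/

theorem map_range_succ {V : Type*} (ρ : ℕ → V) (n : ℕ) :
    (List.range (n + 1)).map ρ = (List.range n).map ρ ++ [ρ n] := by
  simp [List.range_succ]

theorem infi_nonempty {V : Type*} [Finite V] (ρ : ℕ → V) : (infi ρ).Nonempty := by
  by_contra h
  rw [Set.not_nonempty_iff_eq_empty] at h
  have h1 : ∀ v : V, ∀ᶠ n in Filter.atTop, ρ n ≠ v := by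
    intro v
    have : v ∉ infi ρ := by simp [h]
    simpa [infi, Filter.not_frequently] using this
  obtain ⟨n, hn⟩ := (Filter.eventually_all.mpr h1).exists
  exact hn (ρ n) rfl

theorem eventually_mem_infi {V : Type*} [Finite V] (ρ : ℕ → V) :
    ∃ N, ∀ n ≥ N, ρ n ∈ infi ρ := by
  have h1 : ∀ v : V, ∀ᶠ n in Filter.atTop, v ∉ infi ρ → ρ n ≠ v := by
    intro v
    by_cases hv : v ∈ infi ρ
    · simp [hv]
    · have : ∀ᶠ n in Filter.atTop, ρ n ≠ v := by
        simpa [infi, Filter.not_frequently] using hv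
      exact this.mono fun n hn _ => hn
  obtain ⟨N, hN⟩ := Filter.eventually_atTop.mp (Filter.eventually_all.mpr h1)
  refine ⟨N, fun n hn => ?_⟩
  by_contra h
  exact hN n hn (ρ n) h rfl

theorem isLoop_infi {V : Type*} [Finite V] {A : Arena V} {ρ : ℕ → V}
    (hρ : ∀ n, A.Adj (ρ n) (ρ (n + 1))) : A.IsLoop (infi ρ) := by
  refine ⟨infi_nonempty ρ, fun v hv v' hv' => ?_⟩
  obtain ⟨N, hN⟩ := eventually_mem_infi ρ
  obtain ⟨n, hn, rfl⟩ := Filter.frequently_atTop.mp hv N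
  obtain ⟨m, hm, rfl⟩ := Filter.frequently_atTop.mp hv' (n + 1)
  induction m, hm using Nat.le_induction with
  | base => exact .single ⟨hN n hn, hN _ (by omega), hρ n⟩
  | succ m hm ih =>
    exact (ih (hN m (by omega))).tail ⟨hN _ (by omega), hN _ (by omega), hρ m⟩

/-- If the scores of `F` are bounded along a play, then `F` is not its infinity set: otherwise the
score would be constant from some point on, and the accumulator would grow to all of `F`. -/
theorem infi_ne_of_score_le {V : Type*} [Finite V] {F : Set V} {ρ : ℕ → V} {k : ℕ}
    (h : ∀ n, score F ((List.range n).map ρ) ≤ k) : infi ρ ≠ F := by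
  intro hF
  have hne : F.Nonempty := hF ▸ infi_nonempty ρ
  obtain ⟨N, hN⟩ := eventually_mem_infi ρ
  rw [hF] at hN
  obtain ⟨N', hN', hmin⟩ := exists_minimalFor_of_wellFoundedLT (fun n => N ≤ n)
      (fun n => k - score F ((List.range n).map ρ)) ⟨N, le_rfl⟩
  have hmax : ∀ n ≥ N, score F ((List.range n).map ρ) ≤ score F ((List.range N').map ρ) := by
    intro n hn
    by_contra hlt
    have h1 := h n
    have := hmin hn (by dsimp only; omega)
    dsimp only at this
    omega
  have hstep : ∀ n ≥ N', score F ((List.range n).map ρ) = score F ((List.range N').map ρ) →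
      score F ((List.range (n + 1)).map ρ) = score F ((List.range N').map ρ) ∧
      acc F ((List.range (n + 1)).map ρ) = acc F ((List.range n).map ρ) ∪ {ρ n} := by
    intro n hn hs
    have hm := hmax (n + 1) (by omega)
    rw [map_range_succ] at hm ⊢
    rcases score_concat_cases F ((List.range n).map ρ) (ρ n) with
      ⟨hv, -⟩ | ⟨-, -, h2, -⟩ | ⟨-, -, h2, h3⟩
    · exact absurd (hN n (by omega)) hv
    · omega
    · exact ⟨by omega, h3⟩
  have hconst : ∀ n ≥ N', score F ((List.range n).map ρ) = score F ((List.range N').map ρ) := by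
    intro n hn
    induction n, hn using Nat.le_induction with
    | base => rfl
    | succ n hn ih => exact (hstep n hn ih).1
  have hall : ∀ v : V, ∀ᶠ n in Filter.atTop, v ∈ F → v ∈ acc F ((List.range n).map ρ) := by
    intro v
    by_cases hv : v ∈ F
    · rw [← hF] at hv
      obtain ⟨m, hm, rfl⟩ := Filter.frequently_atTop.mp hv N'
      refine Filter.eventually_atTop.mpr ⟨m + 1, fun n hn _ => ?_⟩
      induction n, hn using Nat.le_induction with
      | base => rw [(hstep m hm (hconst m hm)).2]; simp
      | succ n hn ih =>
        have hn' : n ≥ N' := by omega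
        rw [(hstep n hn' (hconst n hn')).2]
        exact Or.inl ih
    · exact Filter.Eventually.of_forall fun n h => absurd h hv
  obtain ⟨n, hn⟩ := (Filter.eventually_all.mpr hall).exists
  exact acc_ne_self hne _ (Set.Subset.antisymm (acc_subset F _) hn)

/-! ### Keeping the opponent's scores bounded -/

/-- A set of histories (a history is a pair `h`, `x`, standing for the word `h x`) that the player
who owns the vertices of `own` can avoid leaving in the subarena `A`, and on which the
scores of the sets `F ∈ Fs` with `F ⊆ A` are at most 2. -/
def KeepsBounded {V : Type*} (Adj : V → V → Prop) (own : Set V) (Fs : Set (Set V)) (A : Set V)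
    (T : List V → V → Prop) : Prop :=
  ∀ h x, T h x → x ∈ A ∧ (∀ F ∈ Fs, F ⊆ A → score F (h ++ [x]) ≤ 2) ∧
    (x ∈ own → ∃ v ∈ A, Adj x v ∧ T (h ++ [x]) v) ∧
    (x ∉ own → ∀ v ∈ A, Adj x v → T (h ++ [x]) v)

/-- After the history `h x`, the owner of `own` can keep the scores of `Fs` at most 2 in `A`. -/
def CanBound {V : Type*} (Adj : V → V → Prop) (own : Set V) (Fs : Set (Set V)) (A : Set V)
    (h : List V) (x : V) : Prop :=
  ∃ T, KeepsBounded Adj own Fs A T ∧ T h x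

theorem keepsBounded_canBound {V : Type*} (Adj : V → V → Prop) (own : Set V) (Fs : Set (Set V))
    (A : Set V) : KeepsBounded Adj own Fs A (CanBound Adj own Fs A) := by
  rintro h x ⟨T, hT, hx⟩
  obtain ⟨h1, h2, h3, h4⟩ := hT h x hx
  refine ⟨h1, h2, fun ho => ?_, fun ho v hv hxv => ⟨T, hT, h4 ho v hv hxv⟩⟩
  obtain ⟨v, hv, hxv, hTv⟩ := h3 ho
  exact ⟨v, hv, hxv, T, hT, hTv⟩

/-- The condition on the history that makes the induction work: the sets of `Fs` inside `A` have
score 0, or score 1 with an empty accumulator. It holds for words of length 1. -/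
def LowScores {V : Type*} (Fs : Set (Set V)) (A : Set V) (w : List V) : Prop :=
  ∀ F ∈ Fs, F ⊆ A → score F w = 0 ∨ (score F w = 1 ∧ acc F w = ∅)

theorem LowScores.mono {V : Type*} {Fs : Set (Set V)} {A B : Set V} {w : List V}
    (h : LowScores Fs A w) (hB : B ⊆ A) : LowScores Fs B w :=
  fun F hF hFB => h F hF (hFB.trans hB)

theorem lowScores_concat_of_eq_zero {V : Type*} {Fs : Set (Set V)} {A : Set V} {w : List V} {v : V}
    (h : ∀ F ∈ Fs, F ⊆ A → v ∈ F → score F w = 0) : LowScores Fs A (w ++ [v]) := by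
  intro F hF hFA
  rcases score_concat_cases F w v with ⟨-, h1, -⟩ | ⟨hv, -, h1, h2⟩ | ⟨hv, -, h1, -⟩
  · exact Or.inl h1
  · exact Or.inr ⟨by rw [h1, h F hF hFA hv], h2⟩
  · exact Or.inl (by rw [h1, h F hF hFA hv])

theorem lowScores_singleton {V : Type*} (Fs : Set (Set V)) (A : Set V) (v : V) :
    LowScores Fs A [v] :=
  lowScores_concat_of_eq_zero (w := []) fun F _ _ _ => score_nil F

/-- The owner of `own` can keep the scores bounded in `A` after every history with low scores that
ends in `A`. -/
def Bounding {V : Type*} (Adj : V → V → Prop) (own : Set V) (Fs : Set (Set V)) (A : Set V) :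
    Prop :=
  ∀ h x, x ∈ A → LowScores Fs A (h ++ [x]) → CanBound Adj own Fs A h x

/-! ### Attractors -/

/-- `R` is the attractor of `Y` in `A` for the owner of `own`: from `R \ Y` this player can force
the rank `rk` to decrease until `Y` is reached, and the opponent can avoid `R` from outside. -/
structure IsAttractor {V : Type*} (Adj : V → V → Prop) (own A Y R : Set V) (rk : V → ℕ) :
    Prop where
  target_subset : Y ⊆ R
  subset : R ⊆ A
  own_of_mem : ∀ x ∈ R, x ∉ Y → x ∈ own → ∃ v ∈ R, Adj x v ∧ rk v < rk x
  opp_of_mem : ∀ x ∈ R, x ∉ Y → x ∉ own → ∀ v ∈ A, Adj x v → v ∈ R ∧ rk v < rk x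
  own_of_notMem : ∀ x ∈ A, x ∉ R → x ∈ own → ∀ v ∈ R, ¬ Adj x v
  opp_of_notMem : ∀ x ∈ A, x ∉ R → x ∉ own → ∃ v ∈ A, v ∉ R ∧ Adj x v

/-- The vertices of `A` from which `Y` can be forced within `n` moves. -/
def attrLevel {V : Type*} (Adj : V → V → Prop) (own A Y : Set V) : ℕ → Set V
  | 0 => Y
  | n + 1 => attrLevel Adj own A Y n ∪
      {x | x ∈ A ∧ ((x ∈ own ∧ ∃ v ∈ attrLevel Adj own A Y n, Adj x v) ∨
        (x ∉ own ∧ ∀ v ∈ A, Adj x v → v ∈ attrLevel Adj own A Y n))}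

theorem exists_isAttractor {V : Type*} [Finite V] (Adj : V → V → Prop) (own A Y : Set V)
    (hY : Y ⊆ A) : ∃ R rk, IsAttractor Adj own A Y R rk := by
  classical
  have hmono : Monotone (attrLevel Adj own A Y) :=
    monotone_nat_of_le_succ fun n => Set.subset_union_left
  have hsub : ∀ n, attrLevel Adj own A Y n ⊆ A := by
    intro n
    induction n with
    | zero => exact hY
    | succ n ih => exact Set.union_subset ih fun x hx => hx.1
  let rk : V → ℕ := fun x => sInf {n | x ∈ attrLevel Adj own A Y n}
  have hrk : ∀ x n, x ∈ attrLevel Adj own A Y n → x ∈ attrLevel Adj own A Y (rk x) :=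
    fun x n hn => Nat.sInf_mem (s := {n | x ∈ attrLevel Adj own A Y n}) ⟨n, hn⟩
  have hle : ∀ x n, x ∈ attrLevel Adj own A Y n → rk x ≤ n :=
    fun x n hn => Nat.sInf_le (s := {n | x ∈ attrLevel Adj own A Y n}) hn
  -- a vertex of the attractor outside `Y` enters it at the level after its successors
  have hpred : ∀ x n, x ∈ attrLevel Adj own A Y n → x ∉ Y → ∃ m, rk x = m + 1 ∧
      x ∉ attrLevel Adj own A Y m ∧ x ∈ attrLevel Adj own A Y (m + 1) := by
    intro x n hn hxY
    have h := hrk x n hn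
    cases hm : rk x with
    | zero => rw [hm] at h; exact absurd h hxY
    | succ m =>
      refine ⟨m, rfl, fun hxm => ?_, hm ▸ h⟩
      have := hle x m hxm
      omega
  obtain ⟨N, hN⟩ := (Set.finite_range rk).bddAbove
  have hN' : ∀ x n, x ∈ attrLevel Adj own A Y n → x ∈ attrLevel Adj own A Y N :=
    fun x n hn => hmono (hN ⟨x, rfl⟩) (hrk x n hn)
  refine ⟨⋃ n, attrLevel Adj own A Y n, rk, ?_, ?_, ?_, ?_, ?_, ?_⟩
  · exact Set.subset_iUnion (attrLevel Adj own A Y) 0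
  · exact Set.iUnion_subset hsub
  · intro x hx hxY ho
    obtain ⟨n, hn⟩ := Set.mem_iUnion.mp hx
    obtain ⟨m, hm, hxm, hxm' | ⟨-, ⟨-, v, hv, hxv⟩ | ⟨hno, -⟩⟩⟩ := hpred x n hn hxY
    · exact absurd hxm' hxm
    · exact ⟨v, Set.mem_iUnion.mpr ⟨m, hv⟩, hxv, by have := hle v m hv; omega⟩
    · exact absurd ho hno
  · intro x hx hxY ho v hvA hxv
    obtain ⟨n, hn⟩ := Set.mem_iUnion.mp hx
    obtain ⟨m, hm, hxm, hxm' | ⟨-, ⟨ho', -⟩ | ⟨-, hall⟩⟩⟩ := hpred x n hn hxY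
    · exact absurd hxm' hxm
    · exact absurd ho' ho
    · have hv := hall v hvA hxv
      exact ⟨Set.mem_iUnion.mpr ⟨m, hv⟩, by have := hle v m hv; omega⟩
  · intro x hxA hx ho v hv hxv
    obtain ⟨n, hn⟩ := Set.mem_iUnion.mp hv
    exact hx (Set.mem_iUnion.mpr ⟨n + 1, Or.inr ⟨hxA, Or.inl ⟨ho, v, hn, hxv⟩⟩⟩)
  · intro x hxA hx ho
    by_contra hcon
    push Not at hcon
    refine hx (Set.mem_iUnion.mpr ⟨N + 1, Or.inr ⟨hxA, Or.inr ⟨ho, fun v hvA hxv => ?_⟩⟩⟩)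
    by_contra hvN
    refine hcon v hvA (fun hv => ?_) hxv
    obtain ⟨n, hn⟩ := Set.mem_iUnion.mp hv
    exact hvN (hN' v n hn)

/-! ### The player for whom the full subarena is good -/

/-- The condition during a phase directed against `C`, while the play is in the subarena `A \ R`
outside the attractor of `A \ C`. -/
def InnerPhase {V : Type*} (Adj : V → V → Prop) (own : Set V) (Fs : Set (Set V)) (A C R : Set V)
    (h : List V) (x : V) : Prop :=
  CanBound Adj own Fs (A \ R) h x ∧ ∀ F ∈ Fs, F ⊆ A →
    (¬ F ⊆ C → score F (h ++ [x]) = 0 ∧ acc F (h ++ [x]) ⊆ C) ∧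
    (F ⊆ C → ¬ F ⊆ A \ R → score F (h ++ [x]) = 0 ∨
      (score F (h ++ [x]) = 1 ∧ acc F (h ++ [x]) ⊆ A \ R))

/-- The condition during a phase directed against `C`, while the play is being attracted to
`A \ C`. A set that has reached the score 2 contains a vertex that is not in its accumulator and
that will not be visited before the phase ends. -/
def AttractingPhase {V : Type*} (Fs : Set (Set V)) (A C R : Set V) (rk : V → ℕ)
    (h : List V) (x : V) : Prop :=
  x ∈ R ∧ x ∈ C ∧ ∀ F ∈ Fs, F ⊆ A →
    (¬ F ⊆ C → score F (h ++ [x]) = 0 ∧ acc F (h ++ [x]) ⊆ C) ∧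
    (F ⊆ C → score F (h ++ [x]) ≤ 1 ∨ (score F (h ++ [x]) = 2 ∧
      ∃ f ∈ F, f ∉ acc F (h ++ [x]) ∧ (f ∉ R ∨ rk x ≤ rk f)))

/-- While the play is in `C`, a set that is not contained in `C` is not completed. -/
theorem score_concat_of_not_subset {V : Type*} {F C : Set V} {w : List V} {v : V}
    (hFC : ¬ F ⊆ C) (h : score F w = 0 ∧ acc F w ⊆ C) (hv : v ∈ C) :
    score F (w ++ [v]) = 0 ∧ acc F (w ++ [v]) ⊆ C := by
  rcases score_concat_cases F w v with ⟨-, h1, h2⟩ | ⟨hvF, ha, -, -⟩ | ⟨-, -, h1, h2⟩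
  · exact ⟨h1, h2 ▸ Set.empty_subset _⟩
  · refine absurd (fun a ha' => ?_) hFC
    by_cases hav : a = v
    · exact hav ▸ hv
    · exact h.2 (ha ▸ ⟨ha', hav⟩)
  · exact ⟨h1.trans h.1, h2 ▸ Set.union_subset h.2 (Set.singleton_subset_iff.mpr hv)⟩

/-- While the play is in `U`, a set that is not contained in `U` is completed at most once, and only
with the help of an accumulator from before. -/
theorem score_concat_of_score_one {V : Type*} {F U : Set V} {w : List V} {v : V}
    (hFU : ¬ F ⊆ U) (h : score F w = 0 ∨ (score F w = 1 ∧ acc F w ⊆ U)) (hv : v ∈ U) :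
    score F (w ++ [v]) = 0 ∨ (score F (w ++ [v]) = 1 ∧ acc F (w ++ [v]) ⊆ U) := by
  rcases score_concat_cases F w v with ⟨-, h1, h2⟩ | ⟨hvF, ha, h1, h2⟩ | ⟨-, -, h1, h2⟩
  · exact Or.inl h1
  · rcases h with h | ⟨h, h'⟩
    · exact Or.inr ⟨by omega, h2 ▸ Set.empty_subset _⟩
    · refine absurd (fun a ha' => ?_) hFU
      by_cases hav : a = v
      · exact hav ▸ hv
      · exact h' (ha ▸ ⟨ha', hav⟩)
  · rcases h with h | ⟨h, h'⟩
    · exact Or.inl (h1.trans h)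
    · exact Or.inr ⟨h1.trans h, h2 ▸ Set.union_subset h' (Set.singleton_subset_iff.mpr hv)⟩

theorem InnerPhase.inner {V : Type*} {Adj : V → V → Prop} {own : Set V} {Fs : Set (Set V)}
    {A C R : Set V} {h : List V} {x v : V} (hAR : A \ R ⊆ C)
    (hp : InnerPhase Adj own Fs A C R h x) (hv : CanBound Adj own Fs (A \ R) (h ++ [x]) v) :
    InnerPhase Adj own Fs A C R (h ++ [x]) v := by
  have hvA : v ∈ A \ R := (keepsBounded_canBound _ _ _ _ _ _ hv).1
  refine ⟨hv, fun F hF hFA => ⟨fun hFC => ?_, fun hFC hFR => ?_⟩⟩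
  · exact score_concat_of_not_subset hFC ((hp.2 F hF hFA).1 hFC) (hAR hvA)
  · exact score_concat_of_score_one hFR ((hp.2 F hF hFA).2 hFC hFR) hvA

theorem InnerPhase.attracting {V : Type*} {Adj : V → V → Prop} {own : Set V} {Fs : Set (Set V)}
    {A C R : Set V} {rk : V → ℕ} {h : List V} {x v : V}
    (hp : InnerPhase Adj own Fs A C R h x) (hvR : v ∈ R) (hvC : v ∈ C) :
    AttractingPhase Fs A C R rk (h ++ [x]) v := by
  refine ⟨hvR, hvC, fun F hF hFA => ⟨fun hFC => ?_, fun hFC => ?_⟩⟩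
  · exact score_concat_of_not_subset hFC ((hp.2 F hF hFA).1 hFC) hvC
  · rcases score_concat_cases F (h ++ [x]) v with ⟨-, h1, -⟩ | ⟨hvF, -, h1, h2⟩ | ⟨hvF, -, h1, h2⟩
    · left; omega
    · have hs := (hp.2 F hF hFA).2 hFC fun hs => (hs hvF).2 hvR
      by_cases h0 : score F (h ++ [x]) = 0
      · left; omega
      · exact Or.inr ⟨by omega, v, hvF, by rw [h2]; simp, Or.inr le_rfl⟩
    · have hs := (hp.2 F hF hFA).2 hFC fun hs => (hs hvF).2 hvR
      left; omega

theorem AttractingPhase.attracting {V : Type*} {Fs : Set (Set V)}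
    {A C R : Set V} {rk : V → ℕ} {h : List V} {x v : V}
    (hp : AttractingPhase Fs A C R rk h x) (hvR : v ∈ R) (hvC : v ∈ C) (hlt : rk v < rk x) :
    AttractingPhase Fs A C R rk (h ++ [x]) v := by
  refine ⟨hvR, hvC, fun F hF hFA => ⟨fun hFC => ?_, fun hFC => ?_⟩⟩
  · exact score_concat_of_not_subset hFC ((hp.2.2 F hF hFA).1 hFC) hvC
  · have hs := (hp.2.2 F hF hFA).2 hFC
    rcases score_concat_cases F (h ++ [x]) v with ⟨-, h1, -⟩ | ⟨hvF, ha, h1, h2⟩ | ⟨hvF, -, h1, h2⟩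
    · left; omega
    · rcases hs with hs | ⟨hs, f, hfF, hfa, hf⟩
      · by_cases h0 : score F (h ++ [x]) = 0
        · left; omega
        · exact Or.inr ⟨by omega, v, hvF, by rw [h2]; simp, Or.inr le_rfl⟩
      · exfalso
        have hfv : f ≠ v := by
          rintro rfl
          rcases hf with hf | hf
          · exact hf hvR
          · omega
        exact hfa (ha ▸ ⟨hfF, hfv⟩)
    · rcases hs with hs | ⟨hs, f, hfF, hfa, hf⟩
      · left; omega
      · have hfv : f ≠ v := by
          rintro rfl
          rcases hf with hf | hf
          · exact hf hvR
          · omega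
        refine Or.inr ⟨by omega, f, hfF, ?_, hf.imp id fun hf => by omega⟩
        rw [h2]
        rintro (hf' | hf')
        · exact hfa hf'
        · exact hfv hf'

/-- A phase directed against `C` ends with low scores. -/
theorem lowScores_of_leave {V : Type*} {Fs : Set (Set V)} {A C : Set V} {w : List V} {v : V}
    (h : ∀ F ∈ Fs, F ⊆ A → ¬ F ⊆ C → score F w = 0) (hv : v ∉ C) :
    LowScores Fs A (w ++ [v]) :=
  lowScores_concat_of_eq_zero fun F hF hFA hvF => h F hF hFA fun hFC => hv (hFC hvF)

/-- Suppose `A ∉ Fs`, and that for each `C ∈ Fs` the player can keep the scores bounded in the part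
of `A` from which `A \ C` cannot be forced. Then the scores can be kept bounded in `A`: play in
phases, each directed against a set `C` that contains all accumulators and all sets of positive
score. -/
theorem bounding_of_forall_inner {V : Type*} [Finite V] {Adj : V → V → Prop} {own : Set V}
    {Fs : Set (Set V)} {A : Set V} (hsub : ∀ x ∈ A, ∃ v ∈ A, Adj x v)
    (H : ∀ C, C ∈ Fs ∨ C = ∅ → C ⊆ A →
      ∀ R rk, IsAttractor Adj own A (A \ C) R rk → Bounding Adj own Fs (A \ R)) :
    Bounding Adj own Fs A := by
  let T : List V → V → Prop := fun h x => x ∈ A ∧ (LowScores Fs A (h ++ [x]) ∨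
    ∃ C R rk, IsAttractor Adj own A (A \ C) R rk ∧
      (InnerPhase Adj own Fs A C R h x ∨ AttractingPhase Fs A C R rk h x))
  have hAR : ∀ {C R rk}, IsAttractor Adj own A (A \ C) R rk → A \ R ⊆ C := by
    intro C R rk hR x hx
    by_contra hxC
    exact hx.2 (hR.target_subset ⟨hx.1, hxC⟩)
  let Good : List V → V → Prop := fun h x => (∀ F ∈ Fs, F ⊆ A → score F (h ++ [x]) ≤ 2) ∧
    (x ∈ own → ∃ v ∈ A, Adj x v ∧ T (h ++ [x]) v) ∧
    (x ∉ own → ∀ v ∈ A, Adj x v → T (h ++ [x]) v)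
  have hinner : ∀ h x C R rk, IsAttractor Adj own A (A \ C) R rk →
      InnerPhase Adj own Fs A C R h x → Good h x := by
    intro h x C R rk hR hp
    obtain ⟨hxU, hsc, hown, hopp⟩ := keepsBounded_canBound _ _ _ _ _ _ hp.1
    refine ⟨fun F hF hFA => ?_, fun ho => ?_, fun ho v hvA hxv => ⟨hvA, ?_⟩⟩
    · by_cases hFU : F ⊆ A \ R
      · exact hsc F hF hFU
      · by_cases hFC : F ⊆ C
        · have := (hp.2 F hF hFA).2 hFC hFU
          omega
        · have := ((hp.2 F hF hFA).1 hFC).1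
          omega
    · obtain ⟨v, hv, hxv, hcan⟩ := hown ho
      exact ⟨v, hv.1, hxv, hv.1, Or.inr ⟨C, R, rk, hR, Or.inl (hp.inner (hAR hR) hcan)⟩⟩
    · by_cases hvR : v ∈ R
      · by_cases hvC : v ∈ C
        · exact Or.inr ⟨C, R, rk, hR, Or.inr (hp.attracting hvR hvC)⟩
        · exact Or.inl (lowScores_of_leave (fun F hF hFA hFC => ((hp.2 F hF hFA).1 hFC).1) hvC)
      · exact Or.inr ⟨C, R, rk, hR, Or.inl (hp.inner (hAR hR) (hopp ho v ⟨hvA, hvR⟩ hxv))⟩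
  have hattr : ∀ h x C R rk, IsAttractor Adj own A (A \ C) R rk →
      AttractingPhase Fs A C R rk h x → Good h x := by
    intro h x C R rk hR hp
    have hnext : ∀ v ∈ R, rk v < rk x → T (h ++ [x]) v := by
      intro v hvR hlt
      refine ⟨hR.subset hvR, ?_⟩
      by_cases hvC : v ∈ C
      · exact Or.inr ⟨C, R, rk, hR, Or.inr (hp.attracting hvR hvC hlt)⟩
      · exact Or.inl (lowScores_of_leave (fun F hF hFA hFC => ((hp.2.2 F hF hFA).1 hFC).1) hvC)
    have hxY : x ∉ A \ C := fun hx => hx.2 hp.2.1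
    refine ⟨fun F hF hFA => ?_, fun ho => ?_, fun ho v hvA hxv => ?_⟩
    · by_cases hFC : F ⊆ C
      · rcases (hp.2.2 F hF hFA).2 hFC with hs | ⟨hs, -⟩ <;> omega
      · have := ((hp.2.2 F hF hFA).1 hFC).1
        omega
    · obtain ⟨v, hv, hxv, hlt⟩ := hR.own_of_mem x hp.1 hxY ho
      exact ⟨v, hR.subset hv, hxv, hnext v hv hlt⟩
    · obtain ⟨hv, hlt⟩ := hR.opp_of_mem x hp.1 hxY ho v hvA hxv
      exact hnext v hv hlt
  have hlow : ∀ h x, x ∈ A → LowScores Fs A (h ++ [x]) → Good h x := by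
    intro h x hxA hl
    -- the set against which the phase starting at `x` is directed
    obtain ⟨C, hC, hCA, hCmax⟩ : ∃ C, (C ∈ Fs ∨ C = ∅) ∧ C ⊆ A ∧ ∀ F ∈ Fs, F ⊆ A →
        acc F (h ++ [x]) ⊆ C ∧ (0 < score F (h ++ [x]) → F ⊆ C) := by
      by_cases hne : ({F | F ∈ Fs ∧ F ⊆ A} : Set (Set V)).Nonempty
      · obtain ⟨C, hC, hmax⟩ := exists_mem_forall_acc_subset _ hne (h ++ [x])
        exact ⟨C, Or.inl hC.1, hC.2, fun F hF hFA => hmax F ⟨hF, hFA⟩⟩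
      · exact ⟨∅, Or.inr rfl, Set.empty_subset _, fun F hF hFA => absurd ⟨F, hF, hFA⟩ hne⟩
    obtain ⟨R, rk, hR⟩ := exists_isAttractor Adj own A (A \ C) Set.sdiff_subset
    have hout : ∀ F ∈ Fs, F ⊆ A → ¬ F ⊆ C → score F (h ++ [x]) = 0 ∧ acc F (h ++ [x]) ⊆ C := by
      intro F hF hFA hFC
      refine ⟨?_, (hCmax F hF hFA).1⟩
      by_contra h0
      exact hFC ((hCmax F hF hFA).2 (by omega))
    by_cases hxR : x ∈ R
    · by_cases hxC : x ∈ C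
      · refine hattr h x C R rk hR ⟨hxR, hxC, fun F hF hFA => ⟨hout F hF hFA, fun _ => ?_⟩⟩
        have := hl F hF hFA
        left; omega
      · -- no set of `Fs` has a positive score at `x`, hence any move leads to low scores again
        have h0 : ∀ F ∈ Fs, F ⊆ A → score F (h ++ [x]) = 0 := by
          intro F hF hFA
          by_contra h0
          have h0 : 0 < score F (h ++ [x]) := by omega
          exact hxC ((hCmax F hF hFA).2 h0 (mem_of_score_pos h0))
        have hnext : ∀ v ∈ A, T (h ++ [x]) v := fun v hv =>
          ⟨hv, Or.inl (lowScores_concat_of_eq_zero fun F hF hFA _ => h0 F hF hFA)⟩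
        refine ⟨fun F hF hFA => by have := h0 F hF hFA; omega, fun _ => ?_,
          fun _ v hv _ => hnext v hv⟩
        obtain ⟨v, hv, hxv⟩ := hsub x hxA
        exact ⟨v, hv, hxv, hnext v hv⟩
    · refine hinner h x C R rk hR ⟨H C hC hCA R rk hR h x ⟨hxA, hxR⟩ (hl.mono Set.sdiff_subset),
        fun F hF hFA => ⟨hout F hF hFA, fun _ _ => ?_⟩⟩
      rcases hl F hF hFA with hs | ⟨hs, ha⟩
      · exact Or.inl hs
      · exact Or.inr ⟨hs, ha ▸ Set.empty_subset _⟩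
  refine fun h x hxA hl => ⟨T, ?_, hxA, Or.inl hl⟩
  rintro h x ⟨hxA, hl | ⟨C, R, rk, hR, hp | hp⟩⟩
  · exact ⟨hxA, hlow h x hxA hl⟩
  · exact ⟨hxA, hinner h x C R rk hR hp⟩
  · exact ⟨hxA, hattr h x C R rk hR hp⟩

/-! ### The player for whom the full subarena is bad -/

/-- If the player can keep the scores bounded in `X`, which the opponent cannot leave, and in `A'`,
then also in the union of `A'` with the attractor `Y` of `X`. -/
theorem bounding_union_attractor {V : Type*} {Adj : V → V → Prop} {own : Set V}
    {Fs : Set (Set V)} {A' X Y : Set V} {rk : V → ℕ} (hXY : X ⊆ Y) (hdisj : ∀ x ∈ A', x ∉ Y)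
    (hA' : Bounding Adj own Fs A') (hX : Bounding Adj own Fs X)
    (hXtrap : ∀ x ∈ X, x ∉ own → ∀ v ∈ A' ∪ Y, Adj x v → v ∈ X)
    (hYown : ∀ x ∈ Y, x ∉ X → x ∈ own → ∃ v ∈ Y, Adj x v ∧ rk v < rk x)
    (hYopp : ∀ x ∈ Y, x ∉ X → x ∉ own → ∀ v ∈ A' ∪ Y, Adj x v → v ∈ Y ∧ rk v < rk x) :
    Bounding Adj own Fs (A' ∪ Y) := by
  -- the three stages of a play: in `A'`, on the way to `X`, in `X`
  let T1 : List V → V → Prop := fun h x => CanBound Adj own Fs A' h x ∧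
    ∀ F ∈ Fs, F ⊆ A' ∪ Y → ¬ F ⊆ A' → score F (h ++ [x]) = 0 ∨
      (score F (h ++ [x]) = 1 ∧ acc F (h ++ [x]) ⊆ A')
  let T2 : List V → V → Prop := fun h x => x ∈ Y ∧ x ∉ X ∧ ∀ F ∈ Fs, F ⊆ A' ∪ Y →
    score F (h ++ [x]) = 0 ∨
    (score F (h ++ [x]) = 1 ∧ ∀ a ∈ acc F (h ++ [x]), a ∉ X) ∨
    (score F (h ++ [x]) = 2 ∧ (∀ a ∈ F, a ∉ X) ∧
      ∃ f ∈ F, f ∉ acc F (h ++ [x]) ∧ (f ∈ A' ∨ rk x ≤ rk f))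
  let T3 : List V → V → Prop := fun h x => CanBound Adj own Fs X h x ∧
    ∀ F ∈ Fs, F ⊆ A' ∪ Y → ¬ F ⊆ X → score F (h ++ [x]) ≤ 1 ∨
      (score F (h ++ [x]) = 2 ∧ acc F (h ++ [x]) ⊆ X)
  let T : List V → V → Prop := fun h x => T1 h x ∨ T2 h x ∨ T3 h x
  -- on entering `X` from outside, the sets inside `X` have score 0
  have hlowX : ∀ h x v, x ∉ X → LowScores Fs X (h ++ [x] ++ [v]) := fun h x v hx =>
    lowScores_concat_of_eq_zero fun F hF hFX _ =>
      (score_concat_of_notMem F h x fun hxF => hx (hFX hxF)).1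
  have h13 : ∀ h x v, T1 h x → v ∈ X → T3 (h ++ [x]) v := by
    intro h x v hT hvX
    have hxA' : x ∈ A' := (keepsBounded_canBound _ _ _ _ _ _ hT.1).1
    refine ⟨hX _ _ hvX (hlowX h x v fun hx => hdisj x hxA' (hXY hx)), fun F hF hFB hFX => ?_⟩
    by_cases hFA' : F ⊆ A'
    · rw [(score_concat_of_notMem F (h ++ [x]) v fun hv => hdisj v (hFA' hv) (hXY hvX)).1]
      simp
    · have hs := hT.2 F hF hFB hFA'
      rcases score_concat_cases F (h ++ [x]) v with ⟨-, h1, -⟩ | ⟨-, -, h1, h2⟩ | ⟨-, -, h1, -⟩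
      · omega
      · rcases hs with hs | ⟨hs, -⟩
        · omega
        · exact Or.inr ⟨by omega, h2 ▸ Set.empty_subset _⟩
      · omega
  have h23 : ∀ h x v, T2 h x → v ∈ X → T3 (h ++ [x]) v := by
    intro h x v hT hvX
    refine ⟨hX _ _ hvX (hlowX h x v hT.2.1), fun F hF hFB hFX => ?_⟩
    have hs := hT.2.2 F hF hFB
    rcases score_concat_cases F (h ++ [x]) v with ⟨-, h1, -⟩ | ⟨hv, -, h1, h2⟩ | ⟨hv, -, h1, -⟩
    · omega
    · rcases hs with hs | ⟨hs, -⟩ | ⟨-, hs, -⟩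
      · omega
      · exact Or.inr ⟨by omega, h2 ▸ Set.empty_subset _⟩
      · exact absurd hvX (hs v hv)
    · rcases hs with hs | ⟨hs, -⟩ | ⟨-, hs, -⟩
      · omega
      · omega
      · exact absurd hvX (hs v hv)
  have h33 : ∀ h x v, T3 h x → CanBound Adj own Fs X (h ++ [x]) v → T3 (h ++ [x]) v := by
    intro h x v hT hv
    have hvX : v ∈ X := (keepsBounded_canBound _ _ _ _ _ _ hv).1
    refine ⟨hv, fun F hF hFB hFX => ?_⟩
    have hs := hT.2 F hF hFB hFX
    rcases score_concat_cases F (h ++ [x]) v with ⟨-, h1, -⟩ | ⟨hv, ha, h1, h2⟩ | ⟨hv, -, h1, h2⟩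
    · omega
    · rcases hs with hs | ⟨-, hs⟩
      · by_cases h0 : score F (h ++ [x]) = 0
        · omega
        · exact Or.inr ⟨by omega, h2 ▸ Set.empty_subset _⟩
      · refine absurd (fun a ha' => ?_) hFX
        by_cases hav : a = v
        · exact hav ▸ hvX
        · exact hs (ha ▸ ⟨ha', hav⟩)
    · rcases hs with hs | ⟨hs, hs'⟩
      · omega
      · exact Or.inr ⟨by omega, h2 ▸ Set.union_subset hs' (Set.singleton_subset_iff.mpr hvX)⟩
  have h12 : ∀ h x v, T1 h x → v ∈ Y → v ∉ X → T2 (h ++ [x]) v := by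
    intro h x v hT hvY hvX
    refine ⟨hvY, hvX, fun F hF hFB => ?_⟩
    have hA'X : ∀ a ∈ A', a ∉ X := fun a ha ha' => hdisj a ha (hXY ha')
    by_cases hFA' : F ⊆ A'
    · exact Or.inl (score_concat_of_notMem F (h ++ [x]) v fun hv => hdisj v (hFA' hv) hvY).1
    · have hs := hT.2 F hF hFB hFA'
      rcases score_concat_cases F (h ++ [x]) v with ⟨-, h1, -⟩ | ⟨hv, ha, h1, h2⟩ | ⟨hv, -, h1, h2⟩
      · omega
      · rcases hs with hs | ⟨hs, hs'⟩
        · exact Or.inr (Or.inl ⟨by omega, by rw [h2]; simp⟩)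
        · refine Or.inr (Or.inr ⟨by omega, fun a haF => ?_, v, hv, by rw [h2]; simp, Or.inr le_rfl⟩)
          by_cases hav : a = v
          · exact hav ▸ hvX
          · exact hA'X a (hs' (ha ▸ ⟨haF, hav⟩))
      · rcases hs with hs | ⟨hs, hs'⟩
        · omega
        · refine Or.inr (Or.inl ⟨by omega, fun a haF => ?_⟩)
          rw [h2] at haF
          rcases haF with haF | haF
          · exact hA'X a (hs' haF)
          · rwa [Set.mem_singleton_iff.mp haF]
  have h22 : ∀ h x v, T2 h x → v ∈ Y → v ∉ X → rk v < rk x → T2 (h ++ [x]) v := by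
    intro h x v hT hvY hvX hlt
    refine ⟨hvY, hvX, fun F hF hFB => ?_⟩
    have hs := hT.2.2 F hF hFB
    have hfv : ∀ f, f ∈ A' ∨ rk x ≤ rk f → f ≠ v := by
      rintro f hf rfl
      rcases hf with hf | hf
      · exact hdisj f hf hvY
      · omega
    rcases score_concat_cases F (h ++ [x]) v with ⟨-, h1, -⟩ | ⟨hv, ha, h1, h2⟩ | ⟨hv, -, h1, h2⟩
    · omega
    · rcases hs with hs | ⟨hs, hs'⟩ | ⟨hs, hs', f, hfF, hfa, hf⟩
      · exact Or.inr (Or.inl ⟨by omega, by rw [h2]; simp⟩)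
      · refine Or.inr (Or.inr ⟨by omega, fun a haF => ?_, v, hv, by rw [h2]; simp, Or.inr le_rfl⟩)
        by_cases hav : a = v
        · exact hav ▸ hvX
        · exact hs' a (ha ▸ ⟨haF, hav⟩)
      · exact absurd (ha ▸ ⟨hfF, hfv f hf⟩) hfa
    · rcases hs with hs | ⟨hs, hs'⟩ | ⟨hs, hs', f, hfF, hfa, hf⟩
      · omega
      · refine Or.inr (Or.inl ⟨by omega, fun a haF => ?_⟩)
        rw [h2] at haF
        rcases haF with haF | haF
        · exact hs' a haF
        · rwa [Set.mem_singleton_iff.mp haF]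
      · refine Or.inr (Or.inr ⟨by omega, hs', f, hfF, ?_, hf.imp id fun hf => by omega⟩)
        rw [h2]
        rintro (hf' | hf')
        · exact hfa hf'
        · exact hfv f hf hf'
  intro h x hxB hl
  refine ⟨T, ?_, ?_⟩
  · rintro h x (hT | hT | hT)
    · obtain ⟨hxA', hsc, hown, hopp⟩ := keepsBounded_canBound _ _ _ _ _ _ hT.1
      have h11 : ∀ v, CanBound Adj own Fs A' (h ++ [x]) v → T (h ++ [x]) v := by
        intro v hv
        have hvA' : v ∈ A' := (keepsBounded_canBound _ _ _ _ _ _ hv).1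
        exact Or.inl ⟨hv, fun F hF hFB hFA' =>
          score_concat_of_score_one hFA' (hT.2 F hF hFB hFA') hvA'⟩
      refine ⟨Or.inl hxA', fun F hF hFB => ?_, fun ho => ?_, fun ho v hvB hxv => ?_⟩
      · by_cases hFA' : F ⊆ A'
        · exact hsc F hF hFA'
        · have := hT.2 F hF hFB hFA'
          omega
      · obtain ⟨v, hv, hxv, hcan⟩ := hown ho
        exact ⟨v, Or.inl hv, hxv, h11 v hcan⟩
      · by_cases hvX : v ∈ X
        · exact Or.inr (Or.inr (h13 h x v hT hvX))
        · rcases hvB with hvB | hvB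
          · exact h11 v (hopp ho v hvB hxv)
          · exact Or.inr (Or.inl (h12 h x v hT hvB hvX))
    · have hnext : ∀ v ∈ Y, rk v < rk x → T (h ++ [x]) v := by
        intro v hvY hlt
        by_cases hvX : v ∈ X
        · exact Or.inr (Or.inr (h23 h x v hT hvX))
        · exact Or.inr (Or.inl (h22 h x v hT hvY hvX hlt))
      refine ⟨Or.inr hT.1, fun F hF hFB => ?_, fun ho => ?_, fun ho v hvB hxv => ?_⟩
      · have := hT.2.2 F hF hFB
        omega
      · obtain ⟨v, hv, hxv, hlt⟩ := hYown x hT.1 hT.2.1 ho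
        exact ⟨v, Or.inr hv, hxv, hnext v hv hlt⟩
      · obtain ⟨hv, hlt⟩ := hYopp x hT.1 hT.2.1 ho v hvB hxv
        exact hnext v hv hlt
    · obtain ⟨hxX, hsc, hown, hopp⟩ := keepsBounded_canBound _ _ _ _ _ _ hT.1
      refine ⟨Or.inr (hXY hxX), fun F hF hFB => ?_, fun ho => ?_, fun ho v hvB hxv => ?_⟩
      · by_cases hFX : F ⊆ X
        · exact hsc F hF hFX
        · have := hT.2 F hF hFB hFX
          omega
      · obtain ⟨v, hv, hxv, hcan⟩ := hown ho
        exact ⟨v, Or.inr (hXY hv), hxv, Or.inr (Or.inr (h33 h x v hT hcan))⟩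
      · exact Or.inr (Or.inr (h33 h x v hT (hopp ho v (hXtrap x hxX ho v hvB hxv) hxv)))
  · by_cases hxX : x ∈ X
    · refine Or.inr (Or.inr ⟨hX h x hxX (hl.mono (hXY.trans Set.subset_union_right)),
        fun F hF hFB _ => ?_⟩)
      have := hl F hF hFB
      omega
    · rcases hxB with hxA' | hxY
      · refine Or.inl ⟨hA' h x hxA' (hl.mono Set.subset_union_left), fun F hF hFB _ => ?_⟩
        rcases hl F hF hFB with hs | ⟨hs, ha⟩
        · exact Or.inl hs
        · exact Or.inr ⟨hs, ha ▸ Set.empty_subset _⟩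
      · refine Or.inr (Or.inl ⟨hxY, hxX, fun F hF hFB => ?_⟩)
        rcases hl F hF hFB with hs | ⟨hs, ha⟩
        · exact Or.inl hs
        · exact Or.inr (Or.inl ⟨hs, by simp [ha]⟩)

/-! ### Splitting a subarena -/

/-- `W` is a part of the subarena `A` that the opponent of the owner of `own` cannot leave and in
which the owner of `own` can keep the scores of `Fs` bounded. -/
structure IsBoundingPart {V : Type*} (Adj : V → V → Prop) (own : Set V) (Fs : Set (Set V))
    (A W : Set V) : Prop where
  subset : W ⊆ A
  own_succ : ∀ x ∈ W, x ∈ own → ∃ v ∈ W, Adj x v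
  opp_succ : ∀ x ∈ W, x ∉ own → ∀ v ∈ A, Adj x v → v ∈ W
  bounding : Bounding Adj own Fs W

/-- Both players together can keep the respective scores bounded from everywhere in `A`. -/
def Splits {V : Type*} (Adj : V → V → Prop) (own : Set V) (Fs : Set (Set V)) (A : Set V) : Prop :=
  ∃ W W', W ∪ W' = A ∧ IsBoundingPart Adj own Fs A W ∧ IsBoundingPart Adj ownᶜ Fsᶜ A W'

theorem Splits.compl {V : Type*} {Adj : V → V → Prop} {own : Set V} {Fs : Set (Set V)} {A : Set V}
    (h : Splits Adj own Fs A) : Splits Adj ownᶜ Fsᶜ A := by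
  obtain ⟨W, W', hW, h, h'⟩ := h
  exact ⟨W', W, by rw [Set.union_comm, hW], h', by rwa [compl_compl, compl_compl]⟩

theorem isBoundingPart_empty {V : Type*} (Adj : V → V → Prop) (own : Set V) (Fs : Set (Set V))
    (A : Set V) : IsBoundingPart Adj own Fs A ∅ :=
  ⟨Set.empty_subset A, fun _ hx => hx.elim, fun _ hx => hx.elim, fun _ _ hx => hx.elim⟩

/-- The induction step for a subarena `A ∉ Fs`. -/
theorem splits_of_notMem {V : Type*} [Finite V] {Adj : V → V → Prop} {own : Set V}
    {Fs : Set (Set V)} {A : Set V} (hsub : ∀ x ∈ A, ∃ v ∈ A, Adj x v) (hA : A ∉ Fs)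
    (hne : A.Nonempty)
    (ih : ∀ B, B ⊂ A → (∀ x ∈ B, ∃ v ∈ B, Adj x v) → Splits Adj own Fs B) :
    Splits Adj own Fs A := by
  by_cases hall : ∀ C, C ∈ Fs ∨ C = ∅ → C ⊆ A →
      ∀ R rk, IsAttractor Adj own A (A \ C) R rk → Bounding Adj own Fs (A \ R)
  · exact ⟨A, ∅, Set.union_empty A, ⟨subset_rfl, fun x hx _ => hsub x hx,
      fun _ _ _ v hv _ => hv, bounding_of_forall_inner hsub hall⟩, isBoundingPart_empty _ _ _ _⟩
  · push Not at hall
    obtain ⟨C, hC, hCA, R, rk, hR, hbad⟩ := hall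
    have hUC : A \ R ⊆ C := by
      intro x hx
      by_contra hxC
      exact hx.2 (hR.target_subset ⟨hx.1, hxC⟩)
    have hCne : C ≠ A := by
      rintro rfl
      rcases hC with hC | rfl
      · exact hA hC
      · exact Set.not_nonempty_empty hne
    -- the opponent has a nonempty bounding part `X` in `A \ R`
    obtain ⟨W, X, hWX, hW, hX⟩ := ih (A \ R)
      ((hUC.trans_ssubset (lt_of_le_of_ne hCA hCne))) (by
        rintro x ⟨hxA, hxR⟩
        by_cases ho : x ∈ own
        · obtain ⟨v, hv, hxv⟩ := hsub x hxA
          exact ⟨v, ⟨hv, fun hvR => hR.own_of_notMem x hxA hxR ho v hvR hxv⟩, hxv⟩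
        · obtain ⟨v, hv, hvR, hxv⟩ := hR.opp_of_notMem x hxA hxR ho
          exact ⟨v, ⟨hv, hvR⟩, hxv⟩)
    have hXne : X.Nonempty := by
      by_contra hX0
      rw [Set.not_nonempty_iff_eq_empty.mp hX0, Set.union_empty] at hWX
      exact hbad (hWX ▸ hW.bounding)
    have hXA : X ⊆ A := hX.subset.trans Set.sdiff_subset
    have hXtrap : ∀ x ∈ X, x ∉ ownᶜ → ∀ v ∈ A, Adj x v → v ∈ X := by
      intro x hx ho v hv hxv
      refine hX.opp_succ x hx ho v ⟨hv, fun hvR => ?_⟩ hxv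
      exact hR.own_of_notMem x (hXA hx) (hX.subset hx).2 (not_not.mp ho) v hvR hxv
    obtain ⟨Y, rk', hY⟩ := exists_isAttractor Adj ownᶜ A X hXA
    -- the rest of the subarena
    obtain ⟨W₀, W₁, hW₀₁, hW₀, hW₁⟩ := ih (A \ Y) (by
        refine ⟨Set.sdiff_subset, fun h => ?_⟩
        obtain ⟨x, hx⟩ := hXne
        exact (h (hXA hx)).2 (hY.target_subset hx)) (by
        rintro x ⟨hxA, hxY⟩
        by_cases ho : x ∈ ownᶜ
        · obtain ⟨v, hv, hxv⟩ := hsub x hxA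
          exact ⟨v, ⟨hv, fun hvY => hY.own_of_notMem x hxA hxY ho v hvY hxv⟩, hxv⟩
        · obtain ⟨v, hv, hvY, hxv⟩ := hY.opp_of_notMem x hxA hxY ho
          exact ⟨v, ⟨hv, hvY⟩, hxv⟩)
    have hW₁Y : W₁ ∪ Y ⊆ A := Set.union_subset (hW₁.subset.trans Set.sdiff_subset) hY.subset
    refine ⟨W₀, W₁ ∪ Y, ?_, ⟨hW₀.subset.trans Set.sdiff_subset, hW₀.own_succ, ?_, hW₀.bounding⟩,
      hW₁Y, ?_, ?_, ?_⟩
    · rw [← Set.union_assoc, hW₀₁, Set.sdiff_union_of_subset hY.subset]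
    · intro x hx ho v hv hxv
      refine hW₀.opp_succ x hx ho v ⟨hv, fun hvY => ?_⟩ hxv
      exact hY.own_of_notMem x (hW₀.subset hx).1 (hW₀.subset hx).2 ho v hvY hxv
    · rintro x (hx | hx) ho
      · obtain ⟨v, hv, hxv⟩ := hW₁.own_succ x hx ho
        exact ⟨v, Or.inl hv, hxv⟩
      · by_cases hxX : x ∈ X
        · obtain ⟨v, hv, hxv⟩ := hX.own_succ x hxX ho
          exact ⟨v, Or.inr (hY.target_subset hv), hxv⟩
        · obtain ⟨v, hv, hxv, -⟩ := hY.own_of_mem x hx hxX ho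
          exact ⟨v, Or.inr hv, hxv⟩
    · rintro x (hx | hx) ho v hv hxv
      · by_cases hvY : v ∈ Y
        · exact Or.inr hvY
        · exact Or.inl (hW₁.opp_succ x hx ho v ⟨hv, hvY⟩ hxv)
      · by_cases hxX : x ∈ X
        · exact Or.inr (hY.target_subset (hXtrap x hxX ho v hv hxv))
        · exact Or.inr (hY.opp_of_mem x hx hxX ho v hv hxv).1
    · exact bounding_union_attractor hY.target_subset (fun x hx => (hW₁.subset hx).2) hW₁.bounding
        hX.bounding (fun x hx ho v hv => hXtrap x hx ho v (hW₁Y hv)) hY.own_of_mem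
        (fun x hx hxX ho v hv => hY.opp_of_mem x hx hxX ho v (hW₁Y hv))

theorem splits_of_serial {V : Type*} [Finite V] (Adj : V → V → Prop) (own : Set V)
    (Fs : Set (Set V)) (A : Set V) (hsub : ∀ x ∈ A, ∃ v ∈ A, Adj x v) : Splits Adj own Fs A := by
  induction A using (wellFounded_lt (α := Set V)).induction with
  | _ A ih =>
    rcases A.eq_empty_or_nonempty with rfl | hne
    · exact ⟨∅, ∅, Set.union_empty ∅, isBoundingPart_empty _ _ _ _, isBoundingPart_empty _ _ _ _⟩
    · by_cases hA : A ∈ Fs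
      · have h := splits_of_notMem (own := ownᶜ) (Fs := Fsᶜ) hsub (fun h => h hA) hne
          fun B hB hBsub => (ih B hB hBsub).compl
        simpa only [compl_compl] using h.compl
      · exact splits_of_notMem hsub hA hne ih

/-- In a part of the arena that the opponent cannot leave, also the scores of the sets that are not
contained in this part stay bounded. -/
theorem IsBoundingPart.canBound_univ {V : Type*} {Adj : V → V → Prop} {own : Set V}
    {Fs : Set (Set V)} {W : Set V} (hW : IsBoundingPart Adj own Fs Set.univ W) {v : V}
    (hv : v ∈ W) : CanBound Adj own Fs Set.univ [] v := by
  refine ⟨fun h x => CanBound Adj own Fs W h x ∧ ∀ F ∈ Fs, ¬ F ⊆ W →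
    score F (h ++ [x]) = 0 ∧ acc F (h ++ [x]) ⊆ W, ?_, ?_⟩
  · rintro h x ⟨hcan, hout⟩
    obtain ⟨hxW, hsc, hown, hopp⟩ := keepsBounded_canBound _ _ _ _ _ _ hcan
    have hnext : ∀ y ∈ W, ∀ F ∈ Fs, ¬ F ⊆ W →
        score F (h ++ [x] ++ [y]) = 0 ∧ acc F (h ++ [x] ++ [y]) ⊆ W :=
      fun y hy F hF hFW => score_concat_of_not_subset hFW (hout F hF hFW) hy
    refine ⟨trivial, fun F hF _ => ?_, fun ho => ?_, fun ho y _ hxy => ?_⟩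
    · by_cases hFW : F ⊆ W
      · exact hsc F hF hFW
      · have := (hout F hF hFW).1
        omega
    · obtain ⟨y, hy, hxy, hcy⟩ := hown ho
      exact ⟨y, trivial, hxy, hcy, hnext y hy⟩
    · have hy := hW.opp_succ x hxW ho y trivial hxy
      exact ⟨hopp ho y hy hxy, hnext y hy⟩
  · refine ⟨hW.bounding [] v hv (lowScores_singleton Fs W v), fun F hF hFW => ?_⟩
    exact score_concat_of_not_subset (w := []) hFW ⟨score_nil F, by simp [acc_nil]⟩ hv

/-- From each vertex, one of the players can keep all scores of the opponent at most 2. -/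
theorem canBound_or_canBound {V : Type*} [Finite V] (A : Arena V) (own : Set V)
    (Fs : Set (Set V)) (v : V) :
    CanBound A.Adj own Fs Set.univ [] v ∨ CanBound A.Adj ownᶜ Fsᶜ Set.univ [] v := by
  obtain ⟨W, W', hWW, hW, hW'⟩ := splits_of_serial A.Adj own Fs Set.univ
    fun x _ => (A.serial x).imp fun y hy => ⟨trivial, hy⟩
  have hv : v ∈ W ∪ W' := hWW ▸ trivial
  exact hv.imp hW.canBound_univ hW'.canBound_univ

/-! ### Strategies and winning regions -/

open scoped Classical in
/-- The histories of the play in which both players follow their strategies. -/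
noncomputable def jointHistory {V : Type*} {A : Arena V} (σ : Strategy A 0) (τ : Strategy A 1)
    (v : V) : ℕ → List V × V :=
  fun n => n.rec ([], v) fun _ p =>
    (p.1 ++ [p.2], if h : p.2 ∈ A.pos 0 then σ.move p.1 ⟨p.2, h⟩ else τ.move p.1 ⟨p.2, h⟩)

theorem exists_mem_beh_inter {V : Type*} {A : Arena V} (σ : Strategy A 0) (τ : Strategy A 1)
    (v : V) : ∃ ρ, ρ ∈ σ.Beh v ∧ ρ ∈ τ.Beh v := by
  set H := jointHistory σ τ v with hH
  have hhist : ∀ n, (H n).1 = (List.range n).map fun k => (H k).2 := by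
    intro n
    induction n with
    | zero => rfl
    | succ n ih => rw [map_range_succ, ← ih]; rfl
  have h0 : ∀ n (h : (H n).2 ∈ A.pos 0), (H (n + 1)).2 = σ.move (H n).1 ⟨(H n).2, h⟩ :=
    fun n h => dif_pos h
  have h1 : ∀ n (h : (H n).2 ∈ A.pos 1), (H (n + 1)).2 = τ.move (H n).1 ⟨(H n).2, h⟩ :=
    fun n h => dif_neg h
  have hadj : ∀ n, A.Adj (H n).2 (H (n + 1)).2 := by
    intro n
    by_cases h : (H n).2 ∈ A.pos 0
    · rw [h0 n h]; exact σ.adj _ ⟨_, h⟩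
    · rw [h1 n h]; exact τ.adj _ ⟨_, h⟩
  exact ⟨fun n => (H n).2, ⟨⟨rfl, hadj⟩, fun n h => by rw [← hhist]; exact h0 n h⟩,
    ⟨⟨rfl, hadj⟩, fun n h => by rw [← hhist]; exact h1 n h⟩⟩

theorem Game.notMem_winRegion_one {V : Type*} (G : Game V) {v : V} (h : v ∈ G.winRegion 0) :
    v ∉ G.winRegion 1 := by
  rintro ⟨τ, hτ⟩
  obtain ⟨σ, hσ⟩ := h
  obtain ⟨ρ, h0, h1⟩ := exists_mem_beh_inter σ τ v
  exact hτ v rfl ρ h1 (hσ v rfl ρ h0)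

/-- Bounded scores on histories yield a strategy that bounds the scores along its plays. -/
theorem exists_strategy_score_le {V : Type*} {A : Arena V} {i : Fin 2} {Fs : Set (Set V)} {v : V}
    (h : CanBound A.Adj (A.pos i) Fs Set.univ [] v) :
    ∃ σ : Strategy A i, ∀ ρ ∈ σ.Beh v, ∀ F ∈ Fs, ∀ n, score F ((List.range n).map ρ) ≤ 2 := by
  classical
  obtain ⟨T, hT, hv⟩ := h
  let σ : Strategy A i :=
    { move := fun w x => if h : ∃ y, A.Adj x y ∧ T (w ++ [x.1]) y then h.choose
        else (A.serial x).choose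
      adj := by
        intro w x
        split_ifs with h
        · exact h.choose_spec.1
        · exact (A.serial x).choose_spec }
  refine ⟨σ, fun ρ hρ F hF => ?_⟩
  have hall : ∀ n, T ((List.range n).map ρ) (ρ n) := by
    intro n
    induction n with
    | zero => rw [hρ.1.1]; exact hv
    | succ n ih =>
      rw [map_range_succ]
      obtain ⟨-, -, hown, hopp⟩ := hT _ _ ih
      by_cases hn : ρ n ∈ A.pos i
      · obtain ⟨y, -, hy⟩ := hown hn
        rw [hρ.2 n hn]
        have hex : ∃ y, A.Adj (ρ n) y ∧ T ((List.range n).map ρ ++ [ρ n]) y := ⟨y, hy⟩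
        have : σ.move ((List.range n).map ρ) ⟨ρ n, hn⟩ = hex.choose := dif_pos hex
        rw [this]
        exact hex.choose_spec.2
      · exact hopp hn _ trivial (hρ.1.2 n)
  rintro (_ | n)
  · exact Nat.zero_le _
  · rw [map_range_succ]
    exact (hT _ _ (hall n)).2.1 F hF (Set.subset_univ F)

theorem mem_winRegion_zero_of_canBound {V : Type*} [Finite V] (G : MullerGame V) {v : V}
    (h : CanBound G.arena.Adj G.arena.pos0 G.F0ᶜ Set.univ [] v) : v ∈ G.toGame.winRegion 0 := by
  obtain ⟨σ, hσ⟩ := exists_strategy_score_le (A := G.arena) (i := 0) h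
  refine ⟨σ, ?_⟩
  rintro _ rfl ρ hρ
  by_contra hF
  exact infi_ne_of_score_le (hσ ρ hρ (infi ρ) hF) rfl

theorem mem_winRegion_one_of_canBound {V : Type*} [Finite V] (G : MullerGame V) {v : V}
    (h : CanBound G.arena.Adj G.arena.pos0ᶜ G.F0 Set.univ [] v) : v ∈ G.toGame.winRegion 1 := by
  obtain ⟨σ, hσ⟩ := exists_strategy_score_le (A := G.arena) (i := 1) h
  refine ⟨σ, ?_⟩
  rintro _ rfl ρ hρ
  exact fun hF => infi_ne_of_score_le (hσ ρ hρ (infi ρ) hF) rfl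

/-- A Muller game is determined, and Player 0 can keep the scores bounded in her winning region. -/
theorem canBound_or_mem_winRegion_one {V : Type*} [Finite V] (G : MullerGame V) (v : V) :
    CanBound G.arena.Adj G.arena.pos0 G.F0ᶜ Set.univ [] v ∨ v ∈ G.toGame.winRegion 1 := by
  refine (canBound_or_canBound G.arena G.arena.pos0 G.F0ᶜ v).imp id fun h => ?_
  rw [compl_compl] at h
  exact mem_winRegion_one_of_canBound G h

/-! ### Safety games -/

/-- A set of safe vertices that Player 1 cannot leave. -/
structure SafetyGame.IsSafeTrap {Q : Type*} (S : SafetyGame Q) (X : Set Q) : Prop where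
  subset : X ⊆ S.safe
  own_succ : ∀ x ∈ X, x ∈ S.arena.pos0 → ∃ y ∈ X, S.arena.Adj x y
  opp_succ : ∀ x ∈ X, x ∉ S.arena.pos0 → ∀ y, S.arena.Adj x y → y ∈ X

theorem SafetyGame.IsSafeTrap.subset_winRegion {Q : Type*} {S : SafetyGame Q} {X : Set Q}
    (hX : S.IsSafeTrap X) : X ⊆ S.toGame.winRegion 0 := by
  classical
  let σ : Strategy S.toGame.arena 0 :=
    { move := fun _ x => if h : ∃ y ∈ X, S.arena.Adj x y then h.choose
        else (S.arena.serial x).choose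
      adj := by
        intro w x
        split_ifs with h
        · exact h.choose_spec.2
        · exact (S.arena.serial x).choose_spec }
  intro v hv
  refine ⟨σ, ?_⟩
  rintro _ rfl ρ hρ
  have hall : ∀ n, ρ n ∈ X := by
    intro n
    induction n with
    | zero => rw [hρ.1.1]; exact hv
    | succ n ih =>
      by_cases hn : ρ n ∈ S.arena.pos0
      · have hex := hX.own_succ _ ih hn
        have : ρ (n + 1) = hex.choose := (hρ.2 n hn).trans (dif_pos hex)
        rw [this]
        exact hex.choose_spec.1
      · exact hX.opp_succ _ ih hn _ (hρ.1.2 n)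
  rintro _ ⟨n, rfl⟩
  exact hX.subset (hall n)

/-- From an attractor of the unsafe vertices, Player 1 wins. -/
theorem SafetyGame.attractor_subset_winRegion {Q : Type*} {S : SafetyGame Q} {R : Set Q}
    {rk : Q → ℕ}
    (hR : IsAttractor S.arena.Adj S.arena.pos0ᶜ Set.univ S.safeᶜ R rk) :
    R ⊆ S.toGame.winRegion 1 := by
  classical
  let σ : Strategy S.toGame.arena 1 :=
    { move := fun _ x => if h : ∃ y ∈ R, S.arena.Adj x y ∧ rk y < rk x then h.choose
        else (S.arena.serial x).choose
      adj := by
        intro w x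
        split_ifs with h
        · exact h.choose_spec.2.1
        · exact (S.arena.serial x).choose_spec }
  intro v hv
  refine ⟨σ, ?_⟩
  rintro _ rfl ρ hρ
  intro hwin
  have hsafe : ∀ n, ρ n ∉ S.safeᶜ := fun n h => h (hwin ⟨n, rfl⟩)
  -- the rank would decrease forever
  have hall : ∀ n, ρ n ∈ R ∧ rk (ρ n) + n ≤ rk (ρ 0) := by
    intro n
    induction n with
    | zero => rw [hρ.1.1]; exact ⟨hv, le_rfl⟩
    | succ n ih =>
      have hlt : ρ (n + 1) ∈ R ∧ rk (ρ (n + 1)) < rk (ρ n) := by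
        by_cases hn : ρ n ∈ S.arena.pos0ᶜ
        · have hex := hR.own_of_mem _ ih.1 (hsafe n) hn
          have : ρ (n + 1) = hex.choose := (hρ.2 n hn).trans (dif_pos hex)
          rw [this]
          exact ⟨hex.choose_spec.1, hex.choose_spec.2.2⟩
        · exact hR.opp_of_mem _ ih.1 (hsafe n) hn _ trivial (hρ.1.2 n)
      exact ⟨hlt.1, by omega⟩
  have := (hall (rk (ρ 0) + 1)).2
  omega

/-- Finite safety games are determined, and the winning region of Player 0 is a safe trap. -/
theorem SafetyGame.isSafeTrap_winRegion {Q : Type*} [Finite Q] (S : SafetyGame Q) :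
    S.IsSafeTrap (S.toGame.winRegion 0) ∧
      S.toGame.winRegion 1 = (S.toGame.winRegion 0)ᶜ := by
  obtain ⟨R, rk, hR⟩ :=
    exists_isAttractor S.arena.Adj S.arena.pos0ᶜ Set.univ S.safeᶜ (Set.subset_univ _)
  have hX : S.IsSafeTrap Rᶜ := by
    refine ⟨?_, fun x hx ho => ?_, fun x hx ho y hxy hy => ?_⟩
    · rw [Set.compl_subset_comm]
      exact hR.target_subset
    · obtain ⟨y, -, hy, hxy⟩ := hR.opp_of_notMem x trivial hx (not_not.mpr ho)
      exact ⟨y, hy, hxy⟩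
    · exact hR.own_of_notMem x trivial hx ho y hy hxy
  have h0 : S.toGame.winRegion 0 = Rᶜ := by
    refine Set.Subset.antisymm (fun v hv hvR => ?_) hX.subset_winRegion
    exact S.toGame.notMem_winRegion_one hv (SafetyGame.attractor_subset_winRegion hR hvR)
  refine ⟨h0 ▸ hX, Set.Subset.antisymm (fun v hv hv0 => ?_) (fun v hv => ?_)⟩
  · exact S.toGame.notMem_winRegion_one hv0 hv
  · rw [h0, compl_compl] at hv
    exact SafetyGame.attractor_subset_winRegion hR hv

/-! ### Classes of play prefixes -/

theorem equivalent_iff {V : Type*} {Fs : Set (Set V)} {w w' : List V} :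
    Equivalent Fs w w' ↔ w.getLast? = w'.getLast? ∧
      ∀ F ∈ Fs, score F w = score F w' ∧ acc F w = acc F w' := by
  constructor
  · rintro ⟨h, h'⟩
    refine ⟨h.1, fun F hF => ?_⟩
    rcases h.2 F hF with a | ⟨a, b⟩ <;> rcases h'.2 F hF with c | ⟨c, d⟩
    · omega
    · omega
    · omega
    · exact ⟨a, b.antisymm d⟩
  · rintro ⟨h, h'⟩
    exact ⟨⟨h, fun F hF => Or.inr ⟨(h' F hF).1, (h' F hF).2.le⟩⟩,
      ⟨h.symm, fun F hF => Or.inr ⟨(h' F hF).1.symm, (h' F hF).2.ge⟩⟩⟩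

theorem Equivalent.concat {V : Type*} {Fs : Set (Set V)} {w w' : List V}
    (h : Equivalent Fs w w') (v : V) : Equivalent Fs (w ++ [v]) (w' ++ [v]) := by
  rw [equivalent_iff] at h ⊢
  refine ⟨by simp, fun F hF => ?_⟩
  have : scoreAcc F w = scoreAcc F w' := Prod.ext (h.2 F hF).1 (h.2 F hF).2
  simp only [score, acc, scoreAcc_concat, this, and_self]

theorem score_le_two_of_mem_playsLt3 {V : Type*} {G : MullerGame V} {w : List V}
    (hw : w ∈ playsLt3 G) {F : Set V} (hF : F ∈ G.F1) : score F w ≤ 2 :=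
  (maxScore_le_iff _ _ 2).mp ((enat_lt_three_iff _).mp hw.2) F hF w hw.1.1 List.prefix_rfl

theorem notMem_playsEq3 {V : Type*} {G : MullerGame V} {w : List V} (hw : w ∈ playsLt3 G) :
    w ∉ playsEq3 G := by
  rintro ⟨-, u, v, -, -, -, h⟩
  exact absurd hw.2 (by rw [h]; exact lt_irrefl _)

theorem score_le_three_of_mem_playsLe3 {V : Type*} {G : MullerGame V} {w : List V}
    (hw : w ∈ playsLe3 G) {F : Set V} (hF : F ∈ G.F1) : score F w ≤ 3 := by
  rcases hw with hw | hw
  · exact (score_le_two_of_mem_playsLt3 hw hF).trans (by norm_num)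
  · obtain ⟨hp, -, -, -, -, -, h⟩ := hw
    exact (maxScore_le_iff _ _ 3).mp h.le F hF w hp.1 List.prefix_rfl

theorem concat_mem_playsLt3 {V : Type*} (G : MullerGame V) {w : List V} {x v : V}
    (hw : w ∈ playsLt3 G) (hx : x ∈ w.getLast?) (hv : G.arena.Adj x v)
    (hs : ∀ F ∈ G.F1, score F (w ++ [v]) ≤ 2) : w ++ [v] ∈ playsLt3 G := by
  rcases concat_mem_playsLe3 G hw hx hv with h | h
  · exact h
  · refine ⟨h.1, (enat_lt_three_iff _).mpr ((maxScore_le_iff _ _ _).mpr fun F hF u hu hp => ?_)⟩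
    rcases List.prefix_concat_iff.mp hp with rfl | hp
    · exact hs F hF
    · exact (maxScore_le_iff _ _ 2).mp ((enat_lt_three_iff _).mp hw.2) F hF u hu hp

theorem cls_eq_iff {V : Type*} {G : MullerGame V} {merge : Bool} {w w' : playsLe3 G} :
    cls G merge w = cls G merge w' ↔
      Equivalent G.F1 w.1 w'.1 ∨ (merge = true ∧ w.1 ∈ playsEq3 G ∧ w'.1 ∈ playsEq3 G) :=
  Quotient.eq (r := vertexSetoid G merge)

theorem equivalent_of_cls_eq {V : Type*} {G : MullerGame V} {merge : Bool} {w w' : playsLe3 G}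
    (h : cls G merge w = cls G merge w') (hw : w.1 ∈ playsLt3 G) :
    Equivalent G.F1 w.1 w'.1 ∧ w'.1 ∈ playsLt3 G := by
  rcases cls_eq_iff.mp h with h | ⟨-, h, -⟩
  · refine ⟨h, ?_⟩
    rcases w'.2 with h' | h'
    · exact h'
    · exact absurd (playsEq3_of_equivalent G h' w.2 h.2) (notMem_playsEq3 hw)
  · exact absurd h (notMem_playsEq3 hw)

theorem exists_cls_eq {V : Type*} {G : MullerGame V} {merge : Bool} (q : SafetyVertex G merge) :
    ∃ w, cls G merge w = q :=
  Quotient.exists_rep q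

theorem cls_mem_safeVertices {V : Type*} {G : MullerGame V} {merge : Bool} {w : playsLe3 G} :
    cls G merge w ∈ safeVertices G merge ↔ w.1 ∈ playsLt3 G := by
  constructor
  · rintro ⟨w', hw', h⟩
    exact (equivalent_of_cls_eq h hw').2
  · exact fun h => ⟨w, h, rfl⟩

theorem cls_mem_pos0 {V : Type*} {G : MullerGame V} {merge : Bool} {w : playsLe3 G} {x : V}
    (hw : w.1 ∈ playsLt3 G) (hx : x ∈ w.1.getLast?) :
    cls G merge w ∈ (safetyArena G merge).pos0 ↔ x ∈ G.arena.pos0 := by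
  constructor
  · rintro ⟨w', h, y, hy, hy0⟩
    rw [← (equivalent_of_cls_eq h.symm hw).1.1.1] at hy
    exact Option.mem_unique hx hy ▸ hy0
  · exact fun h => ⟨w, rfl, x, hx, h⟩

theorem adj_cls_iff {V : Type*} {G : MullerGame V} {merge : Bool} {w : playsLe3 G} {x : V}
    (hw : w.1 ∈ playsLt3 G) (hx : x ∈ w.1.getLast?) (q : SafetyVertex G merge) :
    (safetyArena G merge).Adj (cls G merge w) q ↔
      ∃ v, ∃ hv : G.arena.Adj x v,
        q = cls G merge ⟨w.1 ++ [v], concat_mem_playsLe3 G hw hx hv⟩ := by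
  constructor
  · rintro (⟨u, u', hu, ⟨y, hy, v, hv, hu'⟩, h, rfl⟩ | ⟨h, -⟩)
    · have he := (equivalent_of_cls_eq h hu).1
      rw [he.1.1] at hy
      obtain rfl := Option.mem_unique hx hy
      exact ⟨v, hv, cls_eq_iff.mpr (Or.inl (hu' ▸ he.concat v))⟩
    · exact absurd (cls_mem_safeVertices.mpr hw) h
  · rintro ⟨v, hv, rfl⟩
    exact Or.inl ⟨w, _, hw, ⟨x, hx, v, hv, rfl⟩, rfl, rfl⟩

instance finite_safetyVertex {V : Type*} [Finite V] (G : MullerGame V) (merge : Bool) :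
    Finite (SafetyVertex G merge) := by
  let code : SafetyVertex G merge → Option V × (Set V → Fin 4 × Set V) := fun q =>
    (q.out.1.getLast?, fun F => (Fin.ofNat 4 (score F q.out.1), acc F q.out.1))
  refine Finite.of_injective code fun q q' h => ?_
  have h1 := congrArg Prod.fst h
  have h2 := fun F => congrFun (congrArg Prod.snd h) F
  have hq : cls G merge q.out = cls G merge q'.out := by
    refine cls_eq_iff.mpr (Or.inl (equivalent_iff.mpr ⟨h1, fun F hF => ?_⟩))
    have h3 := congrArg Fin.val (congrArg Prod.fst (h2 F))
    have h4 := score_le_three_of_mem_playsLe3 q.out.2 hF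
    have h5 := score_le_three_of_mem_playsLe3 q'.out.2 hF
    simp only [code, Fin.ofNat] at h3
    have h6 := congrArg Prod.snd (h2 F)
    exact ⟨by omega, h6⟩
  exact (Quotient.out_eq q).symm.trans (hq.trans (Quotient.out_eq q'))

/-! ### From bounded scores to the safety game -/

theorem F1_subset_compl_F0 {V : Type*} (G : MullerGame V) : G.F1 ⊆ G.F0ᶜ := fun _ hF => hF.2

theorem toSafety_mem_winRegion_of_canBound {V : Type*} (G : MullerGame V) (merge : Bool) {v : V}
    (h : CanBound G.arena.Adj G.arena.pos0 G.F0ᶜ Set.univ [] v) :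
    toSafety G merge v ∈ (safetyGame G merge).toGame.winRegion 0 := by
  obtain ⟨T, hT, hv⟩ := h
  let X : Set (SafetyVertex G merge) :=
    {q | ∃ h x, ∃ hw : h ++ [x] ∈ playsLt3 G, T h x ∧ q = cls G merge ⟨h ++ [x], Or.inl hw⟩}
  have hlast : ∀ (h : List V) x, x ∈ (h ++ [x]).getLast? := by simp
  have hnext : ∀ h x (hw : h ++ [x] ∈ playsLt3 G) y (hxy : G.arena.Adj x y), T (h ++ [x]) y →
      cls G merge ⟨h ++ [x] ++ [y], concat_mem_playsLe3 G hw (hlast h x) hxy⟩ ∈ X := by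
    intro h x hw y hxy hTy
    exact ⟨h ++ [x], y, concat_mem_playsLt3 G hw (hlast h x) hxy fun F hF =>
      (hT _ _ hTy).2.1 F (F1_subset_compl_F0 G hF) (Set.subset_univ F), hTy, rfl⟩
  have hX : (safetyGame G merge).IsSafeTrap X := by
    refine ⟨?_, ?_, ?_⟩
    · rintro _ ⟨h, x, hw, -, rfl⟩
      exact cls_mem_safeVertices.mpr hw
    · rintro _ ⟨h, x, hw, hTx, rfl⟩ ho
      obtain ⟨y, -, hxy, hTy⟩ := (hT _ _ hTx).2.2.1 ((cls_mem_pos0 hw (hlast h x)).mp ho)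
      exact ⟨_, hnext h x hw y hxy hTy, (adj_cls_iff hw (hlast h x) _).mpr ⟨y, hxy, rfl⟩⟩
    · rintro _ ⟨h, x, hw, hTx, rfl⟩ ho q hq
      obtain ⟨y, hxy, rfl⟩ := (adj_cls_iff hw (hlast h x) _).mp hq
      have hx : x ∉ G.arena.pos0 := fun hx => ho ((cls_mem_pos0 hw (hlast h x)).mpr hx)
      exact hnext h x hw y hxy ((hT _ _ hTx).2.2.2 hx y trivial hxy)
  exact hX.subset_winRegion ⟨[], v, singleton_mem_playsLt3 G v, hv, rfl⟩

/-! ### From the safety game to finite-state strategies -/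

/-- `q'` is the class of `w v` where `q` is the class of the safe play prefix `w`. -/
def IsExtension {V : Type*} (G : MullerGame V) (merge : Bool) (q : SafetyVertex G merge) (v : V)
    (q' : SafetyVertex G merge) : Prop :=
  ∃ w w' : playsLe3 G, w.1 ∈ playsLt3 G ∧ cls G merge w = q ∧ w'.1 = w.1 ++ [v] ∧
    q' = cls G merge w'

theorem IsExtension.eq {V : Type*} {G : MullerGame V} {merge : Bool} {u u' : playsLe3 G} {v : V}
    {q q' : SafetyVertex G merge} (h : IsExtension G merge q v q') (hq : q = cls G merge u)
    (hu' : u'.1 = u.1 ++ [v]) : q' = cls G merge u' := by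
  obtain ⟨w, w', hw, rfl, hw', rfl⟩ := h
  refine cls_eq_iff.mpr (Or.inl ?_)
  rw [hu', hw']
  exact (equivalent_of_cls_eq hq hw).1.concat v

theorem MemoryStructure.updateStar_concat {V M : Type*} (𝔐 : MemoryStructure V M) (w : List V)
    (y v : V) : 𝔐.updateStar (w ++ [y]) v = 𝔐.update (𝔐.updateStar w y) v := by
  cases w with
  | nil => rfl
  | cons x w =>
    simp only [List.cons_append, MemoryStructure.updateStar, List.foldl_append]
    rfl

/-- The classes in a safe trap of the safety game serve as the memory of a strategy for the Muller
game that keeps the scores of Player 1 at most 2. -/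
theorem exists_finiteState_strategy {V : Type*} [Finite V] (G : MullerGame V) (merge : Bool)
    {X : Set (SafetyVertex G merge)} (hX : (safetyGame G merge).IsSafeTrap X) (hne : X.Nonempty) :
    ∃ (𝔐 : MemoryStructure V X) (nxt : NextMove G.toGame.arena 0 X),
      G.toGame.IsWinningFrom (nxt.strategy 𝔐) {v | toSafety G merge v ∈ X} := by
  classical
  let 𝔐 : MemoryStructure V X :=
    { init := fun v => if h : toSafety G merge v ∈ X then ⟨_, h⟩ else ⟨_, hne.some_mem⟩
      update := fun q v => if h : ∃ q' : X, IsExtension G merge q v q' then h.choose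
        else ⟨_, hne.some_mem⟩ }
  let nxt : NextMove G.toGame.arena 0 X :=
    { next := fun x q => if h : ∃ y, G.arena.Adj x y ∧ ∃ q' : X, IsExtension G merge q y q' then
        h.choose else (G.arena.serial x).choose
      adj := by
        intro x q
        split_ifs with h
        · exact h.choose_spec.1
        · exact (G.arena.serial x).choose_spec }
  refine ⟨𝔐, nxt, fun v hv ρ hρ => ?_⟩
  have hlast : ∀ n, ρ n ∈ ((List.range (n + 1)).map ρ).getLast? := by
    intro n
    simp [map_range_succ]
  have hall : ∀ n, ∃ hw : (List.range (n + 1)).map ρ ∈ playsLt3 G,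
      (𝔐.updateStar ((List.range n).map ρ) (ρ n)).1 = cls G merge ⟨_, Or.inl hw⟩ := by
    intro n
    induction n with
    | zero =>
      have h0 : ρ 0 = v := hρ.1.1
      refine ⟨?_, ?_⟩
      · simpa using singleton_mem_playsLt3 G (ρ 0)
      · have : 𝔐.updateStar ((List.range 0).map ρ) (ρ 0) = ⟨toSafety G merge (ρ 0), h0 ▸ hv⟩ :=
          dif_pos (h0 ▸ hv)
        rw [this]
        rfl
    | succ n ih =>
      obtain ⟨hw, hm⟩ := ih
      have hmX : cls G merge ⟨_, Or.inl hw⟩ ∈ X := hm ▸ Subtype.coe_prop _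
      -- every successor whose class is in `X` can be remembered
      have hext : ∀ y (hy : G.arena.Adj (ρ n) y),
          cls G merge ⟨_, concat_mem_playsLe3 G hw (hlast n) hy⟩ ∈ X →
          ∃ q' : X, IsExtension G merge
            (𝔐.updateStar ((List.range n).map ρ) (ρ n)) y q' := by
        intro y hy hyX
        exact ⟨⟨_, hyX⟩, ⟨_, Or.inl hw⟩, ⟨_, concat_mem_playsLe3 G hw (hlast n) hy⟩, hw, hm.symm,
          rfl, rfl⟩
      have hstep : ∃ q' : X, IsExtension G merge
          (𝔐.updateStar ((List.range n).map ρ) (ρ n)) (ρ (n + 1)) q' := by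
        by_cases hn : ρ n ∈ G.arena.pos0
        · obtain ⟨q, hqX, hq⟩ := hX.own_succ _ hmX ((cls_mem_pos0 hw (hlast n)).mpr hn)
          obtain ⟨y, hy, rfl⟩ := (adj_cls_iff hw (hlast n) _).mp hq
          have hex : ∃ y, G.arena.Adj (ρ n) y ∧ ∃ q' : X, IsExtension G merge
            (𝔐.updateStar ((List.range n).map ρ) (ρ n)) y q' := ⟨y, hy, hext y hy hqX⟩
          have : ρ (n + 1) = hex.choose := (hρ.2 n hn).trans (dif_pos hex)
          rw [this]
          exact hex.choose_spec.2
        · exact hext _ (hρ.1.2 n) (hX.opp_succ _ hmX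
            (fun h => hn ((cls_mem_pos0 hw (hlast n)).mp h)) _
            ((adj_cls_iff hw (hlast n) _).mpr ⟨_, hρ.1.2 n, rfl⟩))
      have hle : (List.range (n + 1 + 1)).map ρ ∈ playsLe3 G := by
        rw [map_range_succ]
        exact concat_mem_playsLe3 G hw (hlast n) (hρ.1.2 n)
      have hmem : (𝔐.updateStar ((List.range (n + 1)).map ρ) (ρ (n + 1))).1 =
          cls G merge ⟨_, hle⟩ := by
        have h1 : 𝔐.updateStar ((List.range (n + 1)).map ρ) (ρ (n + 1)) = hstep.choose := by
          rw [map_range_succ, MemoryStructure.updateStar_concat]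
          exact dif_pos hstep
        have h2 := hstep.choose_spec
        rw [h1]
        exact h2.eq hm (map_range_succ ρ (n + 1))
      have hlt : (List.range (n + 1 + 1)).map ρ ∈ playsLt3 G := by
        have : cls G merge ⟨_, hle⟩ ∈ X := hmem ▸ Subtype.coe_prop _
        exact cls_mem_safeVertices.mp (hX.subset this)
      exact ⟨hlt, hmem⟩
  by_contra hF0
  refine infi_ne_of_score_le (F := infi ρ) (ρ := ρ) (k := 2) (fun n => ?_) rfl
  cases n with
  | zero => exact Nat.zero_le _
  | succ n =>
    exact score_le_two_of_mem_playsLt3 (hall n).1 ⟨isLoop_infi hρ.1.2, hF0⟩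

/-! ### The winning regions -/

theorem mem_winRegion_zero_of_toSafety {V : Type*} [Finite V] (G : MullerGame V) (merge : Bool)
    {v : V} (h : toSafety G merge v ∈ (safetyGame G merge).toGame.winRegion 0) :
    v ∈ G.toGame.winRegion 0 := by
  obtain ⟨𝔐, nxt, hwin⟩ := exists_finiteState_strategy G merge
    (safetyGame G merge).isSafeTrap_winRegion.1 ⟨_, h⟩
  refine ⟨nxt.strategy 𝔐, ?_⟩
  rintro _ rfl
  exact hwin _ h

theorem mem_winRegion_zero_iff {V : Type*} [Finite V] (G : MullerGame V) (merge : Bool) (v : V) :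
    v ∈ G.toGame.winRegion 0 ↔
      toSafety G merge v ∈ (safetyGame G merge).toGame.winRegion 0 := by
  refine ⟨fun h => ?_, mem_winRegion_zero_of_toSafety G merge⟩
  rcases canBound_or_mem_winRegion_one G v with h' | h'
  · exact toSafety_mem_winRegion_of_canBound G merge h'
  · exact absurd h' (G.toGame.notMem_winRegion_one h)

theorem mem_winRegion_iff {V : Type*} [Finite V] (G : MullerGame V) (merge : Bool) (i : Fin 2)
    (v : V) : v ∈ G.toGame.winRegion i ↔
      toSafety G merge v ∈ (safetyGame G merge).toGame.winRegion i := by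
  have h0 := mem_winRegion_zero_iff G merge v
  have h1 : v ∈ G.toGame.winRegion 1 ↔
      toSafety G merge v ∈ (safetyGame G merge).toGame.winRegion 1 := by
    rw [(safetyGame G merge).isSafeTrap_winRegion.2, Set.mem_compl_iff, ← h0]
    constructor
    · exact fun h h' => G.toGame.notMem_winRegion_one h' h
    · exact fun h => (canBound_or_mem_winRegion_one G v).resolve_left
        fun h' => h (mem_winRegion_zero_of_canBound G h')
  rcases Fin.exists_fin_two.mp ⟨i, rfl⟩ with rfl | rfl
  · exact h0
  · exact h1

/-! ### Counting classes -/

theorem dedup_suffix_dedup {V : Type*} [DecidableEq V] {x w : List V} (h : x <:+ w) :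
    x.dedup <:+ w.dedup := by
  obtain ⟨y, rfl⟩ := h
  induction y with
  | nil => exact List.suffix_rfl
  | cons a y ih =>
    rw [List.cons_append]
    by_cases ha : a ∈ y ++ x
    · rwa [List.dedup_cons_of_mem ha]
    · rw [List.dedup_cons_of_notMem ha]
      exact ih.trans (List.suffix_cons a _)

theorem exists_suffix_of_suffix_dedup {V : Type*} [DecidableEq V] {y w : List V}
    (h : y <:+ w.dedup) : ∃ x, x <:+ w ∧ ∀ a, a ∈ x ↔ a ∈ y := by
  induction w with
  | nil => exact ⟨[], List.nil_suffix, by simp [List.suffix_nil.mp h]⟩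
  | cons b w ih =>
    by_cases hb : b ∈ w
    · rw [List.dedup_cons_of_mem hb] at h
      obtain ⟨x, hx, hxy⟩ := ih h
      exact ⟨x, hx.trans (List.suffix_cons b w), hxy⟩
    · rw [List.dedup_cons_of_notMem hb] at h
      rcases List.suffix_cons_iff.mp h with rfl | h
      · exact ⟨b :: w, List.suffix_rfl, by simp⟩
      · obtain ⟨x, hx, hxy⟩ := ih h
        exact ⟨x, hx.trans (List.suffix_cons b w), hxy⟩

theorem ncard_setOf_mem {V : Type*} {y : List V} (hy : y.Nodup) :
    ({a | a ∈ y} : Set V).ncard = y.length := by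
  classical
  rw [← List.toFinset_card_of_nodup hy, ← Set.ncard_coe_finset]
  congr 1
  ext a
  simp

/-- A set of score 0 has a maximal accumulator. -/
theorem subset_acc_of_score_eq_zero {V : Type*} {F : Set V} {w x : List V}
    (hs : score F w = 0) (hx : x <:+ w) (hxF : {a | a ∈ x} ⊆ F) : {a | a ∈ x} ⊆ acc F w := by
  induction w using List.reverseRecOn generalizing x with
  | nil =>
    rw [List.suffix_nil.mp hx]
    simp
  | append_singleton w v ih =>
    rcases List.eq_nil_or_concat x with rfl | ⟨x', b, rfl⟩
    · simp
    · rw [List.concat_eq_append] at hx hxF ⊢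
      obtain ⟨y, hy⟩ := hx
      rw [← List.append_assoc] at hy
      obtain ⟨rfl, hb⟩ := List.append_inj' hy rfl
      obtain rfl : b = v := by simpa using hb
      rcases score_concat_cases F (y ++ x') b with ⟨hb, -⟩ | ⟨-, -, h, -⟩ | ⟨-, -, h1, h2⟩
      · exact absurd (hxF (by simp)) hb
      · omega
      · rw [h2]
        have := ih (h1 ▸ hs) (List.suffix_append y x') fun a ha => hxF (by
          simp only [Set.mem_ofPred_eq, List.mem_append] at ha ⊢
          exact Or.inl ha)
        intro a ha
        simp only [Set.mem_ofPred_eq, List.mem_append, List.mem_singleton] at ha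
        exact ha.imp (fun h => this h) id

/-- The order of the last occurrences, together with the scores and the sizes of the accumulators
of the sets that are final segments of this order, determine the equivalence class. -/
theorem equivalent_of_dedup_eq {V : Type*} [DecidableEq V] {Fs : Set (Set V)} {w w' : List V}
    (hd : w.dedup = w'.dedup)
    (h : ∀ y, y ≠ [] → y <:+ w.dedup → {a | a ∈ y} ∈ Fs →
      score {a | a ∈ y} w = score {a | a ∈ y} w' ∧
      (acc {a | a ∈ y} w).ncard = (acc {a | a ∈ y} w').ncard) (hFs : ∅ ∉ Fs) :
    Equivalent Fs w w' := by
  have hlast : ∀ u : List V, u.dedup.getLast? = u.getLast? := by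
    intro u
    rcases List.eq_nil_or_concat u with rfl | ⟨u, b, rfl⟩
    · rfl
    · rw [List.concat_eq_append]
      obtain ⟨y, hy⟩ := dedup_suffix_dedup (List.suffix_append u [b])
      rw [← hy]
      simp
  have hsuf : ∀ {u x : List V}, x <:+ u → ∃ y, y <:+ u.dedup ∧ {a | a ∈ x} = {a | a ∈ y} :=
    fun {u x} hx => ⟨x.dedup, dedup_suffix_dedup hx, by ext a; simp⟩
  rw [equivalent_iff]
  refine ⟨by rw [← hlast w, ← hlast w', hd], fun F hF => ?_⟩
  by_cases hF' : ∃ y, y <:+ w.dedup ∧ F = {a | a ∈ y}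
  · obtain ⟨y, hy, rfl⟩ := hF'
    have hne : y ≠ [] := by
      rintro rfl
      simp only [List.not_mem_nil] at hF
      exact hFs hF
    obtain ⟨hs, hc⟩ := h y hne hy hF
    refine ⟨hs, ?_⟩
    obtain ⟨x₁, hx₁, h₁⟩ := exists_suffix_acc {a | a ∈ y} w
    obtain ⟨x₂, hx₂, h₂⟩ := exists_suffix_acc {a | a ∈ y} w'
    obtain ⟨y₁, hy₁, e₁⟩ := hsuf hx₁
    obtain ⟨y₂, hy₂, e₂⟩ := hsuf hx₂
    rw [h₁, h₂, e₁, e₂] at hc ⊢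
    rw [← hd] at hy₂
    rw [ncard_setOf_mem (w.nodup_dedup.sublist hy₁.sublist),
      ncard_setOf_mem (w.nodup_dedup.sublist hy₂.sublist)] at hc
    rw [List.IsSuffix.eq_of_length (List.suffix_of_suffix_length_le hy₁ hy₂ hc.le) hc]
  · have h0 : ∀ u : List V, u.dedup = w.dedup → score F u = 0 := by
      intro u hu
      by_contra hs
      obtain ⟨x, hx, e⟩ := exists_suffix_of_score_pos F u (by omega)
      obtain ⟨y, hy, e'⟩ := hsuf hx
      exact hF' ⟨y, hu ▸ hy, e.trans e'⟩
    have hle : ∀ u u' : List V, u.dedup = w.dedup → u'.dedup = w.dedup → acc F u ⊆ acc F u' := by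
      intro u u' hu hu'
      obtain ⟨x, hx, e⟩ := exists_suffix_acc F u
      obtain ⟨y, hy, e'⟩ := hsuf hx
      rw [hu, ← hu'] at hy
      obtain ⟨x', hx', e''⟩ := exists_suffix_of_suffix_dedup hy
      have hset : {a | a ∈ x'} = acc F u := by
        rw [e, e']
        ext a
        exact e'' a
      rw [← hset]
      exact subset_acc_of_score_eq_zero (h0 u' hu') hx' (hset ▸ acc_subset F u)
    exact ⟨by rw [h0 w rfl, h0 w' hd.symm], (hle w w' rfl hd.symm).antisymm (hle w' w hd.symm rfl)⟩

/-- Codes of safe classes: `k + 1` is the number of visited vertices, the embedding is the order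
of the last occurrences, and for each `j` there are a score (1 or 2) and the size of an accumulator
for the set of the `j + 1` vertices visited last. -/
abbrev ClassCode (V : Type*) : Type _ :=
  Σ k : Fin (Nat.card V), (Fin (k + 1) ↪ V) × ((j : Fin (k + 1)) → Bool × Fin (j + 1))

open scoped Classical in
/-- The code `c` describes the class of `w`. -/
def ClassCode.Describes {V : Type*} (Fs : Set (Set V)) (c : ClassCode V) (w : List V) : Prop :=
  w.dedup = List.ofFn c.2.1 ∧ ∀ j : Fin (c.1 + 1), {a | a ∈ w.dedup.drop (c.1 - j)} ∈ Fs →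
    score {a | a ∈ w.dedup.drop (c.1 - j)} w = (if (c.2.2 j).1 then 2 else 1) ∧
    (acc {a | a ∈ w.dedup.drop (c.1 - j)} w).ncard = (c.2.2 j).2

theorem ClassCode.Describes.equivalent {V : Type*} {Fs : Set (Set V)} {c : ClassCode V}
    {w w' : List V} (h : c.Describes Fs w) (h' : c.Describes Fs w') (hFs : ∅ ∉ Fs) :
    Equivalent Fs w w' := by
  classical
  have hd : w.dedup = w'.dedup := h.1.trans h'.1.symm
  refine equivalent_of_dedup_eq hd (fun y hne hy hyF => ?_) hFs
  have hlen : w.dedup.length = c.1 + 1 := by rw [h.1, List.length_ofFn]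
  have hpos : 0 < y.length := List.length_pos_iff.mpr hne
  have hle := hy.length_le
  let j : Fin (c.1 + 1) := ⟨y.length - 1, by omega⟩
  have hyd : y = w.dedup.drop (c.1 - j) := by
    have : (c.1 : ℕ) - (j : ℕ) = w.dedup.length - y.length := by
      simp only [j]
      omega
    rw [this]
    exact List.suffix_iff_eq_drop.mp hy
  have h1 := h.2 j
  have h2 := h'.2 j
  rw [← hd, ← hyd] at h2
  rw [← hyd] at h1
  exact ⟨(h1 hyF).1.trans (h2 hyF).1.symm, (h1 hyF).2.trans (h2 hyF).2.symm⟩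

theorem exists_classCode {V : Type*} [Finite V] {Fs : Set (Set V)} {w : List V} (hw : w ≠ [])
    (hs : ∀ F ∈ Fs, score F w ≤ 2) : ∃ c : ClassCode V, c.Describes Fs w := by
  classical
  have := Fintype.ofFinite V
  have hpos : 0 < w.dedup.length := List.length_pos_iff.mpr (by simpa using hw)
  obtain ⟨k, hk⟩ : ∃ k, w.dedup.length = k + 1 := ⟨w.dedup.length - 1, by omega⟩
  have hkn : k < Nat.card V := by
    have := w.nodup_dedup.length_le_card
    rw [Nat.card_eq_fintype_card]
    omega
  have hg : ∀ j : Fin (k + 1), ∃ p : Bool × Fin (j + 1),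
      {a | a ∈ w.dedup.drop (k - j)} ∈ Fs →
      score {a | a ∈ w.dedup.drop (k - j)} w = (if p.1 then 2 else 1) ∧
      (acc {a | a ∈ w.dedup.drop (k - j)} w).ncard = p.2 := by
    intro j
    set y := w.dedup.drop (k - j) with hy
    have hysuf : y <:+ w.dedup := List.drop_suffix _ _
    have hylen : y.length = j + 1 := by
      rw [hy, List.length_drop, hk]
      omega
    have hSne : ({a | a ∈ y} : Set V).Nonempty := by
      obtain ⟨a, ha⟩ := List.exists_mem_of_ne_nil y (List.length_pos_iff.mp (by omega))
      exact ⟨a, ha⟩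
    have h1 : score {a | a ∈ y} w ≠ 0 := by
      intro h0
      obtain ⟨x, hx, hxy⟩ := exists_suffix_of_suffix_dedup hysuf
      have e : {a | a ∈ x} = {a | a ∈ y} := Set.ext hxy
      have := subset_acc_of_score_eq_zero h0 hx e.le
      rw [e] at this
      exact acc_ne_self hSne w ((acc_subset _ w).antisymm this)
    have h2 : (acc {a | a ∈ y} w).ncard < j + 1 := by
      rw [← hylen, ← ncard_setOf_mem (w.nodup_dedup.sublist hysuf.sublist)]
      exact Set.ncard_lt_ncard (lt_of_le_of_ne (acc_subset _ w) (acc_ne_self hSne w))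
    refine ⟨(decide (score {a | a ∈ y} w = 2), ⟨_, h2⟩), fun hF => ⟨?_, rfl⟩⟩
    have := hs _ hF
    by_cases h3 : score {a | a ∈ y} w = 2
    · simp [h3]
    · simp only [h3, decide_false, Bool.false_eq_true, if_false]
      omega
  choose g hg using hg
  refine ⟨⟨⟨k, hkn⟩, ⟨fun i => w.dedup.get (Fin.cast hk.symm i), ?_⟩, g⟩, ?_, hg⟩
  · exact (List.nodup_iff_injective_get.mp w.nodup_dedup).comp (Fin.cast_injective _)
  · refine List.ext_get (by simp [hk]) fun i h1 h2 => ?_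
    rw [List.get_ofFn]
    rfl

theorem card_classCode (V : Type*) [Finite V] : Nat.card (ClassCode V) =
    ∑ k ∈ Finset.Icc 1 (Nat.card V),
      (Nat.card V).choose k * k.factorial * 2 ^ k * k.factorial := by
  classical
  have := Fintype.ofFinite V
  rw [Nat.card_eq_fintype_card, Fintype.card_sigma, ← Finset.Ico_add_one_right_eq_Icc,
    Finset.sum_Ico_eq_sum_range, Nat.add_sub_cancel, Finset.sum_range]
  refine Finset.sum_congr rfl fun k _ => ?_
  rw [Fintype.card_prod, Fintype.card_embedding_eq, Fintype.card_fin, Fintype.card_pi,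
    Nat.descFactorial_eq_factorial_mul_choose, ← Nat.card_eq_fintype_card (α := V)]
  simp only [Fintype.card_prod, Fintype.card_bool, Fintype.card_fin]
  rw [Finset.prod_mul_distrib, Finset.prod_const, Finset.card_univ, Fintype.card_fin,
    Fin.prod_univ_eq_prod_range (fun j => j + 1), Finset.prod_range_add_one_eq_factorial,
    add_comm 1 (k : ℕ)]
  ring

theorem card_safetyVertex_le {V : Type*} [Finite V] (G : MullerGame V) :
    Nat.card (SafetyVertex G true) ≤ (∑ k ∈ Finset.Icc 1 (Nat.card V),
      (Nat.card V).choose k * k.factorial * 2 ^ k * k.factorial) + 1 := by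
  classical
  have hempty : ∅ ∉ G.F1 := fun h => Set.not_nonempty_empty h.1.1
  have hcode : ∀ q : SafetyVertex G true, ∃ c : Option (ClassCode V),
      match c with
      | none => q ∉ safeVertices G true
      | some c => ∃ w : playsLe3 G, w.1 ∈ playsLt3 G ∧ cls G true w = q ∧ c.Describes G.F1 w.1 := by
    intro q
    by_cases hq : q ∈ safeVertices G true
    · obtain ⟨w, hw, rfl⟩ := hq
      obtain ⟨c, hc⟩ := exists_classCode hw.1.1 fun F hF => score_le_two_of_mem_playsLt3 hw hF
      exact ⟨some c, w, hw, rfl, hc⟩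
    · exact ⟨none, hq⟩
  choose f hf using hcode
  have hinj : Function.Injective f := by
    intro q q' h
    have h1 := hf q
    have h2 := hf q'
    rw [← h] at h2
    cases hc : f q with
    | none =>
      rw [hc] at h1 h2
      obtain ⟨w, rfl⟩ := exists_cls_eq q
      obtain ⟨w', rfl⟩ := exists_cls_eq q'
      exact cls_eq_iff.mpr (Or.inr ⟨rfl,
        w.2.resolve_left fun hw => h1 (cls_mem_safeVertices.mpr hw),
        w'.2.resolve_left fun hw => h2 (cls_mem_safeVertices.mpr hw)⟩)
    | some c =>
      rw [hc] at h1 h2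
      obtain ⟨w, -, rfl, hw⟩ := h1
      obtain ⟨w', -, rfl, hw'⟩ := h2
      exact cls_eq_iff.mpr (Or.inl (hw.equivalent hw' hempty))
  have hle := Nat.card_le_card_of_injective f hinj
  rwa [Finite.card_option, card_classCode] at hle

/-- The summand for `k + 1` at `n + 1` is `2 * (n + 1) * (k + 1)` times the summand for `k` at
`n`. -/
theorem sum_succ_le (n : ℕ) : ∑ k ∈ Finset.Icc 1 (n + 1),
      (n + 1).choose k * k.factorial * 2 ^ k * k.factorial ≤
    2 * (n + 1) ^ 2 * ((∑ k ∈ Finset.Icc 1 n, n.choose k * k.factorial * 2 ^ k * k.factorial) + 1)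
    := by
  have h1 : (∑ k ∈ Finset.Icc 1 n, n.choose k * k.factorial * 2 ^ k * k.factorial) + 1 =
      ∑ k ∈ Finset.range (n + 1), n.choose k * k.factorial * 2 ^ k * k.factorial := by
    rw [Finset.range_eq_Ico, Finset.sum_eq_sum_Ico_succ_bot (by omega),
      Finset.Ico_add_one_right_eq_Icc]
    simp [add_comm]
  rw [h1, ← Finset.Ico_add_one_right_eq_Icc, Finset.sum_Ico_eq_sum_range, Nat.add_sub_cancel,
    Finset.mul_sum]
  refine Finset.sum_le_sum fun k hk => ?_
  have hk : k ≤ n := by simpa [Nat.lt_succ_iff] using hk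
  have h2 : (n + 1).choose (k + 1) * (k + 1).factorial = (n + 1) * (n.choose k * k.factorial) := by
    rw [Nat.factorial_succ, ← mul_assoc, ← Nat.add_one_mul_choose_eq]
    ring
  rw [add_comm 1 k, h2, Nat.factorial_succ]
  calc (n + 1) * (n.choose k * k.factorial) * 2 ^ (k + 1) * ((k + 1) * k.factorial)
      = 2 * ((n + 1) * (k + 1)) * (n.choose k * k.factorial * 2 ^ k * k.factorial) := by ring
    _ ≤ 2 * (n + 1) ^ 2 * (n.choose k * k.factorial * 2 ^ k * k.factorial) := by
        gcongr
        rw [sq]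
        gcongr

theorem sum_add_one_le_factorial_pow {n : ℕ} (hn : 4 ≤ n) : (∑ k ∈ Finset.Icc 1 n,
      n.choose k * k.factorial * 2 ^ k * k.factorial) + 1 ≤ n.factorial ^ 3 := by
  induction n, hn using Nat.le_induction with
  | base => simp [Finset.sum_Icc_succ_top, Nat.choose, Nat.factorial]
  | succ n hn ih =>
    have h1 : 1 ≤ n.factorial ^ 3 := Nat.one_le_pow _ _ n.factorial_pos
    calc _ ≤ 2 * (n + 1) ^ 2 * n.factorial ^ 3 + n.factorial ^ 3 := by
          gcongr
          exact (sum_succ_le n).trans (by gcongr)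
      _ = (2 * (n + 1) ^ 2 + 1) * n.factorial ^ 3 := by ring
      _ ≤ (n + 1) ^ 3 * n.factorial ^ 3 := by
          gcongr
          nlinarith
      _ = (n + 1).factorial ^ 3 := by rw [Nat.factorial_succ, mul_pow]

/-! ### Primitive recursive list operations -/

section Primrec

variable {α β γ : Type*} [Primcodable α] [Primcodable β] [Primcodable γ]

theorem primrecPred_forall_mem {f : α → List β} {p : α → β → Prop} (hf : Primrec f)
    (hp : PrimrecRel p) : PrimrecPred fun a => ∀ b ∈ f a, p a b :=
  (PrimrecRel.forall_mem_list (R := fun b a => p a b)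
    (hp.comp Primrec.snd Primrec.fst)).comp hf Primrec.id

theorem primrecPred_exists_mem {f : α → List β} {p : α → β → Prop} (hf : Primrec f)
    (hp : PrimrecRel p) : PrimrecPred fun a => ∃ b ∈ f a, p a b :=
  (PrimrecRel.exists_mem_list (R := fun b a => p a b)
    (hp.comp Primrec.snd Primrec.fst)).comp hf Primrec.id

theorem primrecPred_imp {p q : α → Prop} (hp : PrimrecPred p) (hq : PrimrecPred q) :
    PrimrecPred fun a => p a → q a :=
  (hp.not.or hq).of_eq fun _ => imp_iff_not_or.symm

theorem primrecPred_iff {p q : α → Prop} (hp : PrimrecPred p) (hq : PrimrecPred q) :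
    PrimrecPred fun a => (p a ↔ q a) :=
  ((primrecPred_imp hp hq).and (primrecPred_imp hq hp)).of_eq fun _ => iff_def.symm

theorem primrecPred_eq {f g : α → β} (hf : Primrec f) (hg : Primrec g) :
    PrimrecPred fun a => f a = g a := by
  classical exact Primrec.eq.comp hf hg

theorem primrecPred_mem {f : α → β} {g : α → List β} (hf : Primrec f) (hg : Primrec g) :
    PrimrecPred fun a => f a ∈ g a :=
  (primrecPred_exists_mem (p := fun a b => b = f a) hg
    (primrecPred_eq Primrec.snd (hf.comp Primrec.fst))).of_eq fun _ => by simp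

theorem primrec_filter {f : α → List β} {p : α → β → Prop} [∀ a b, Decidable (p a b)]
    (hf : Primrec f) (hp : PrimrecRel p) : Primrec fun a => (f a).filter fun b => p a b :=
  (PrimrecRel.listFilter (R := fun b a => p a b)
    (hp.comp Primrec.snd Primrec.fst)).comp hf Primrec.id

theorem primrec_sublists' : Primrec (List.sublists' : List α → List (List α)) := by
  refine (Primrec.list_foldr (f := fun l : List α => l) (g := fun _ => [[]])
    (h := fun _ p => p.2 ++ p.2.map (List.cons p.1)) Primrec.id (Primrec.const _) ?_).of_eq ?_
  · refine Primrec.list_append.comp (Primrec.snd.comp Primrec.snd)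
      (Primrec.list_map (Primrec.snd.comp Primrec.snd) ?_)
    exact Primrec.list_cons.comp (Primrec.fst.comp (Primrec.snd.comp Primrec.fst)) Primrec.snd
  · intro l
    induction l with
    | nil => rfl
    | cons a l ih => rw [List.foldr_cons, ih, List.sublists'_cons]

theorem primrec_sections : Primrec (List.sections : List (List α) → List (List α)) := by
  refine (Primrec.list_foldr (f := fun l : List (List α) => l) (g := fun _ => [[]])
    (h := fun _ p => p.2.flatMap fun s => p.1.map fun a => a :: s) Primrec.id
    (Primrec.const _) ?_).of_eq ?_
  · refine Primrec.list_flatMap (Primrec.snd.comp Primrec.snd) ?_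
    refine Primrec.list_map (Primrec.fst.comp (Primrec.snd.comp Primrec.fst)) ?_
    exact Primrec.list_cons.comp Primrec.snd (Primrec.snd.comp Primrec.fst)
  · intro l
    induction l with
    | nil => rfl
    | cons a l ih => rw [List.foldr_cons, ih, List.sections]

theorem primrec_dedup [DecidableEq α] : Primrec (List.dedup : List α → List α) := by
  refine (Primrec.list_foldr (f := fun l : List α => l) (g := fun _ => [])
    (h := fun _ p => if p.1 ∈ p.2 then p.2 else p.1 :: p.2) Primrec.id
    (Primrec.const _) ?_).of_eq ?_
  · have h1 : Primrec fun x : List α × α × List α => x.2.1 := Primrec.fst.comp Primrec.snd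
    have h2 : Primrec fun x : List α × α × List α => x.2.2 := Primrec.snd.comp Primrec.snd
    exact Primrec.ite (primrecPred_mem h1 h2) h2 (Primrec.list_cons.comp h1 h2)
  · intro l
    induction l with
    | nil => rfl
    | cons a l ih =>
      rw [List.foldr_cons, ih]
      by_cases ha : a ∈ l
      · rw [if_pos (List.mem_dedup.mpr ha), List.dedup_cons_of_mem ha]
      · rw [if_neg (List.mem_dedup.not.mpr ha), List.dedup_cons_of_notMem ha]

end Primrec

/-! ### The algorithm -/

/-- Codes of vertices of the safety game: the last vertex, and for each `F ∈ F1` the triple of `F`,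
its score, and its accumulator. Sets of vertices are coded by sublists of `[0, …, n - 1]`. -/
abbrev StateCode : Type := ℕ × List (List ℕ × ℕ × List ℕ)

/-- `F` is a loop: from each vertex of `F`, each subset of `F` that contains the successors of the
vertex in `F` and is closed under successors in `F` is all of `F`. -/
def IsLoopCode (edges : List (ℕ × ℕ)) (F : List ℕ) : Prop :=
  F ≠ [] ∧ ∀ v ∈ F, ∀ S ∈ F.sublists', (∀ x ∈ F, (v, x) ∈ edges → x ∈ S) →
    (∀ y ∈ S, ∀ x ∈ F, (y, x) ∈ edges → x ∈ S) → ∀ x ∈ F, x ∈ S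

open scoped Classical in
/-- The list of the sets in `F1`. -/
noncomputable def F1Code (c : MullerCode) : List (List ℕ) :=
  (List.range c.1).sublists'.filter fun F => IsLoopCode c.2.2.1 F ∧
    ¬ ∃ l ∈ c.2.2.2, ∀ x ∈ List.range c.1, (x ∈ F ↔ x ∈ l)

/-- The counterpart of `scoreStep`. -/
def scoreStepCode (F : List ℕ) (p : ℕ × List ℕ) (v : ℕ) : ℕ × List ℕ :=
  if v ∉ F then (0, [])
  else if p.2 = F.filter (fun x => x ≠ v) then (p.1 + 1, [])
  else (p.1, F.filter fun x => x ∈ p.2 ∨ x = v)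

/-- The state code after a move to `v`. -/
def stepCode (s : StateCode) (v : ℕ) : StateCode :=
  (v, s.2.map fun p => (p.1, scoreStepCode p.1 p.2 v))

/-- The code of the empty word; its last vertex is a dummy. -/
noncomputable def emptyCode (c : MullerCode) : StateCode :=
  (0, (F1Code c).map fun F => (F, 0, []))

/-- All codes of states with scores at most 3, reachable or not. -/
noncomputable def allCodes (c : MullerCode) : List StateCode :=
  (List.range c.1).flatMap fun v =>
    ((F1Code c).map fun F => (List.range 4).flatMap fun k => F.sublists'.map fun a =>
      (F, k, a)).sections.map fun l => (v, l)

/-- All scores are at most 2. -/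
def IsSafeCode (s : StateCode) : Prop := ∀ p ∈ s.2, p.2.1 ≤ 2

/-- `S` contains the codes of the words of length 1 and is closed under the moves from safe
codes. -/
def IsClosedCode (c : MullerCode) (S : List StateCode) : Prop :=
  (∀ v ∈ List.range c.1, stepCode (emptyCode c) v ∈ S) ∧
    ∀ s ∈ S, IsSafeCode s → ∀ v ∈ List.range c.1, (s.1, v) ∈ c.2.2.1 → stepCode s v ∈ S

open scoped Classical in
/-- The codes of play prefixes, as the intersection of all closed sets. -/
noncomputable def reachCodes (c : MullerCode) : List StateCode :=
  (allCodes c).filter fun s => ∀ S ∈ (allCodes c).sublists', IsClosedCode c S → s ∈ S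

open scoped Classical in
/-- In the merged game, all codes that are not safe are replaced by one of them. -/
noncomputable def mergeCode (merge : Bool) (s : StateCode) : StateCode :=
  if merge = true ∧ ¬ IsSafeCode s then (0, [([], 3, [])]) else s

/-- The vertices of the safety game, without repetitions. -/
noncomputable def vertexCodes (merge : Bool) (c : MullerCode) : List StateCode :=
  ((reachCodes c).map (mergeCode merge)).dedup

/-- The number of the vertex of the safety game with code `s`. -/
noncomputable def vertexIndex (merge : Bool) (c : MullerCode) (s : StateCode) : ℕ :=
  (vertexCodes merge c).idxOf (mergeCode merge s)

open scoped Classical in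
/-- The safety game. Owners and edges are read off from the reachable codes before merging, as the
owners of the vertices that are not safe are lost by merging. -/
noncomputable def safetyCode (merge : Bool) (c : MullerCode) : SafetyCode :=
  ((vertexCodes merge c).length,
    ((reachCodes c).filter fun s => s.1 ∈ c.2.1).map (vertexIndex merge c),
    (((reachCodes c).filter fun s => IsSafeCode s).flatMap fun s =>
      ((List.range c.1).filter fun v => (s.1, v) ∈ c.2.2.1).map fun v =>
        (vertexIndex merge c s, vertexIndex merge c (stepCode s v))) ++
      ((reachCodes c).filter fun s => ¬ IsSafeCode s).map fun s =>
        (vertexIndex merge c s, vertexIndex merge c s),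
    ((reachCodes c).filter fun s => IsSafeCode s).map (vertexIndex merge c))

/-- The safety game together with the map `v ↦ [v]`. -/
noncomputable def reduction (merge : Bool) (c : MullerCode) : SafetyCode × List ℕ :=
  (safetyCode merge c,
    (List.range c.1).map fun v => vertexIndex merge c (stepCode (emptyCode c) v))

/-! ### Computability of the algorithm -/

section

open scoped Classical

variable {α : Type*} [Primcodable α]

theorem primrecPred_isLoopCode {f : α → List (ℕ × ℕ)} {g : α → List ℕ} (hf : Primrec f)
    (hg : Primrec g) : PrimrecPred fun a => IsLoopCode (f a) (g a) := by
  refine (primrecPred_eq hg (Primrec.const [])).not.and ?_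
  refine primrecPred_forall_mem hg ?_
  refine primrecPred_forall_mem (primrec_sublists'.comp (hg.comp Primrec.fst)) ?_
  have hg' : Primrec fun x : (α × ℕ) × List ℕ => g x.1.1 := hg.comp (Primrec.fst.comp Primrec.fst)
  have hf' : Primrec fun x : (α × ℕ) × List ℕ => f x.1.1 := hf.comp (Primrec.fst.comp Primrec.fst)
  have hv : Primrec fun x : (α × ℕ) × List ℕ => x.1.2 := Primrec.snd.comp Primrec.fst
  refine primrecPred_imp ?_ (primrecPred_imp ?_ ?_)
  · refine primrecPred_forall_mem hg' ?_
    exact primrecPred_imp (primrecPred_mem (Primrec.pair (hv.comp Primrec.fst) Primrec.snd)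
      (hf'.comp Primrec.fst)) (primrecPred_mem Primrec.snd (Primrec.snd.comp Primrec.fst))
  · refine primrecPred_forall_mem Primrec.snd ?_
    refine primrecPred_forall_mem (hg'.comp Primrec.fst) ?_
    exact primrecPred_imp (primrecPred_mem (Primrec.pair (Primrec.snd.comp Primrec.fst) Primrec.snd)
      (hf'.comp (Primrec.fst.comp Primrec.fst)))
      (primrecPred_mem Primrec.snd (Primrec.snd.comp (Primrec.fst.comp Primrec.fst)))
  · refine primrecPred_forall_mem hg' ?_
    exact primrecPred_mem Primrec.snd (Primrec.snd.comp Primrec.fst)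

theorem primrec_edges : Primrec fun c : MullerCode => c.2.2.1 :=
  Primrec.fst.comp (Primrec.snd.comp Primrec.snd)

theorem primrec_vertices : Primrec fun c : MullerCode => List.range c.1 :=
  Primrec.list_range.comp Primrec.fst

theorem primrec_F1Code : Primrec F1Code := by
  refine primrec_filter (primrec_sublists'.comp primrec_vertices) ?_
  refine (primrecPred_isLoopCode (primrec_edges.comp Primrec.fst) Primrec.snd).and ?_
  refine (primrecPred_exists_mem
    ((Primrec.snd.comp (Primrec.snd.comp Primrec.snd)).comp Primrec.fst) ?_).not
  refine primrecPred_forall_mem (primrec_vertices.comp (Primrec.fst.comp Primrec.fst)) ?_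
  exact primrecPred_iff
    (primrecPred_mem Primrec.snd (Primrec.snd.comp (Primrec.fst.comp Primrec.fst)))
    (primrecPred_mem Primrec.snd (Primrec.snd.comp Primrec.fst))

theorem primrec_scoreStepCode {F : α → List ℕ} {p : α → ℕ × List ℕ} {v : α → ℕ} (hF : Primrec F)
    (hp : Primrec p) (hv : Primrec v) : Primrec fun a => scoreStepCode (F a) (p a) (v a) := by
  refine Primrec.ite (primrecPred_mem hv hF).not (Primrec.const _) (Primrec.ite ?_ ?_ ?_)
  · refine primrecPred_eq (Primrec.snd.comp hp) (primrec_filter hF ?_)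
    exact (primrecPred_eq Primrec.snd (hv.comp Primrec.fst)).not
  · exact Primrec.pair (Primrec.succ.comp (Primrec.fst.comp hp)) (Primrec.const _)
  · refine Primrec.pair (Primrec.fst.comp hp) (primrec_filter hF ?_)
    exact (primrecPred_mem Primrec.snd (Primrec.snd.comp (hp.comp Primrec.fst))).or
      (primrecPred_eq Primrec.snd (hv.comp Primrec.fst))

theorem primrec_stepCode : Primrec₂ stepCode := by
  refine Primrec.pair Primrec.snd (Primrec.list_map (Primrec.snd.comp Primrec.fst) ?_)
  exact Primrec.pair (Primrec.fst.comp Primrec.snd) (primrec_scoreStepCode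
    (Primrec.fst.comp Primrec.snd) (Primrec.snd.comp Primrec.snd)
    (Primrec.snd.comp Primrec.fst))

theorem primrec_emptyCode : Primrec emptyCode :=
  Primrec.pair (Primrec.const 0) (Primrec.list_map primrec_F1Code
    (Primrec.pair Primrec.snd (Primrec.const (0, []))))

theorem primrec_allCodes : Primrec allCodes := by
  refine Primrec.list_flatMap primrec_vertices (Primrec.list_map (primrec_sections.comp ?_)
    (Primrec.pair (Primrec.snd.comp Primrec.fst) Primrec.snd))
  refine Primrec.list_map (primrec_F1Code.comp Primrec.fst)
    (Primrec.list_flatMap (Primrec.const _) (Primrec.list_map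
      (primrec_sublists'.comp (Primrec.snd.comp Primrec.fst)) ?_))
  exact Primrec.pair (Primrec.snd.comp (Primrec.fst.comp Primrec.fst))
    (Primrec.pair (Primrec.snd.comp Primrec.fst) Primrec.snd)

theorem primrecPred_isSafeCode : PrimrecPred IsSafeCode :=
  primrecPred_forall_mem Primrec.snd
    (Primrec.nat_le.comp (Primrec.fst.comp (Primrec.snd.comp Primrec.snd)) (Primrec.const 2))

theorem primrecRel_isClosedCode : PrimrecRel IsClosedCode := by
  have hn : Primrec fun x : MullerCode × List StateCode => List.range x.1.1 :=
    primrec_vertices.comp Primrec.fst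
  refine PrimrecPred.and ?_ ?_
  · refine primrecPred_forall_mem hn (primrecPred_mem ?_ (Primrec.snd.comp Primrec.fst))
    exact primrec_stepCode.comp (primrec_emptyCode.comp (Primrec.fst.comp Primrec.fst)) Primrec.snd
  · refine primrecPred_forall_mem Primrec.snd (primrecPred_imp
      (primrecPred_isSafeCode.comp Primrec.snd)
      (primrecPred_forall_mem (hn.comp Primrec.fst) (primrecPred_imp ?_ ?_)))
    · exact primrecPred_mem (Primrec.pair (Primrec.fst.comp (Primrec.snd.comp Primrec.fst))
        Primrec.snd)
        (primrec_edges.comp (Primrec.fst.comp (Primrec.fst.comp Primrec.fst)))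
    · exact primrecPred_mem (primrec_stepCode.comp (Primrec.snd.comp Primrec.fst) Primrec.snd)
        (Primrec.snd.comp (Primrec.fst.comp Primrec.fst))

theorem primrec_reachCodes : Primrec reachCodes := by
  refine primrec_filter primrec_allCodes ?_
  refine primrecPred_forall_mem (primrec_sublists'.comp (primrec_allCodes.comp Primrec.fst)) ?_
  exact primrecPred_imp (primrecRel_isClosedCode.comp (Primrec.fst.comp Primrec.fst) Primrec.snd)
    (primrecPred_mem (Primrec.snd.comp Primrec.fst) Primrec.snd)

theorem primrec_mergeCode (merge : Bool) : Primrec (mergeCode merge) :=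
  Primrec.ite ((primrecPred_eq (Primrec.const merge) (Primrec.const true)).and
    primrecPred_isSafeCode.not) (Primrec.const _) Primrec.id

theorem primrec_vertexCodes (merge : Bool) : Primrec (vertexCodes merge) :=
  primrec_dedup.comp (Primrec.list_map primrec_reachCodes
    ((primrec_mergeCode merge).comp Primrec.snd))

theorem primrec_vertexIndex (merge : Bool) : Primrec₂ (vertexIndex merge) := by
  refine Primrec.of_eq (Primrec.list_idxOf.comp ((primrec_mergeCode merge).comp Primrec.snd)
    ((primrec_vertexCodes merge).comp Primrec.fst)) fun p => ?_
  unfold vertexIndex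
  congr 1
  exact lawful_beq_subsingleton _ _

theorem primrec_safetyCode (merge : Bool) : Primrec (safetyCode merge) := by
  have hsafe : Primrec fun c : MullerCode => (reachCodes c).filter fun s => IsSafeCode s :=
    primrec_filter primrec_reachCodes (primrecPred_isSafeCode.comp Primrec.snd)
  refine Primrec.pair (Primrec.list_length.comp (primrec_vertexCodes merge))
    (Primrec.pair ?_ (Primrec.pair (Primrec.list_append.comp ?_ ?_) ?_))
  · refine Primrec.list_map (primrec_filter primrec_reachCodes ?_) (primrec_vertexIndex merge)
    exact primrecPred_mem (Primrec.fst.comp Primrec.snd)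
      (Primrec.fst.comp (Primrec.snd.comp Primrec.fst))
  · refine Primrec.list_flatMap hsafe (Primrec.list_map
      (primrec_filter (primrec_vertices.comp Primrec.fst) ?_) (Primrec.pair ?_ ?_))
    · exact primrecPred_mem (Primrec.pair (Primrec.fst.comp (Primrec.snd.comp Primrec.fst))
        Primrec.snd) (primrec_edges.comp (Primrec.fst.comp Primrec.fst))
    · exact (primrec_vertexIndex merge).comp (Primrec.fst.comp Primrec.fst)
        (Primrec.snd.comp Primrec.fst)
    · exact (primrec_vertexIndex merge).comp (Primrec.fst.comp Primrec.fst)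
        (primrec_stepCode.comp (Primrec.snd.comp Primrec.fst) Primrec.snd)
  · exact Primrec.list_map (primrec_filter primrec_reachCodes
      (primrecPred_isSafeCode.comp Primrec.snd).not)
      (Primrec.pair (primrec_vertexIndex merge) (primrec_vertexIndex merge))
  · exact Primrec.list_map hsafe (primrec_vertexIndex merge)

theorem primrec_reduction (merge : Bool) : Primrec (reduction merge) :=
  Primrec.pair (primrec_safetyCode merge) (Primrec.list_map primrec_vertices
    ((primrec_vertexIndex merge).comp Primrec.fst
      (primrec_stepCode.comp (primrec_emptyCode.comp Primrec.fst) Primrec.snd)))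

end

/-! ### Correctness of the algorithm -/

section

open scoped Classical

variable {V : Type*} {n : ℕ} (e : V ≃ Fin n)

/-- The sublist of `[0, …, n - 1]` that codes a set of vertices. -/
noncomputable def setCode (F : Set V) : List ℕ :=
  (List.range n).filter fun x => ∃ v ∈ F, (e v : ℕ) = x

/-- The set of vertices coded by a list. -/
def codeSet (l : List ℕ) : Set V := {v | (e v : ℕ) ∈ l}

theorem mem_setCode {F : Set V} {x : ℕ} : x ∈ setCode e F ↔ ∃ v ∈ F, (e v : ℕ) = x := by
  simp only [setCode, List.mem_filter, List.mem_range, decide_eq_true_eq, and_iff_right_iff_imp]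
  rintro ⟨v, -, rfl⟩
  exact (e v).2

theorem coe_mem_setCode {F : Set V} {v : V} : (e v : ℕ) ∈ setCode e F ↔ v ∈ F := by
  rw [mem_setCode]
  refine ⟨?_, fun h => ⟨v, h, rfl⟩⟩
  rintro ⟨u, hu, h⟩
  rwa [← e.injective (Fin.val_injective h)]

theorem mem_codeSet {l : List ℕ} {v : V} : v ∈ codeSet e l ↔ (e v : ℕ) ∈ l := Iff.rfl

theorem codeSet_setCode (F : Set V) : codeSet e (setCode e F) = F :=
  Set.ext fun _ => coe_mem_setCode e

theorem setCode_sublist (F : Set V) : (setCode e F).Sublist (List.range n) :=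
  List.filter_sublist

theorem exists_eq_of_lt {x : ℕ} (hx : x < n) : ∃ v, (e v : ℕ) = x :=
  ⟨e.symm ⟨x, hx⟩, by simp⟩

theorem eq_of_sublist_range {l l' : List ℕ} (hl : l.Sublist (List.range n))
    (hl' : l'.Sublist (List.range n)) (h : ∀ v, (e v : ℕ) ∈ l ↔ (e v : ℕ) ∈ l') : l = l' := by
  have hp := List.pairwise_lt_range (n := n)
  refine List.Perm.eq_of_pairwise' ((hp.sublist hl).imp le_of_lt) ((hp.sublist hl').imp le_of_lt)
    ((List.perm_ext_iff_of_nodup (List.nodup_range.sublist hl)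
      (List.nodup_range.sublist hl')).mpr fun x => ?_)
  constructor <;> intro hx
  · obtain ⟨v, rfl⟩ := exists_eq_of_lt e (List.mem_range.mp (hl.subset hx))
    exact (h v).mp hx
  · obtain ⟨v, rfl⟩ := exists_eq_of_lt e (List.mem_range.mp (hl'.subset hx))
    exact (h v).mpr hx

theorem setCode_injective : Function.Injective (setCode e) :=
  Function.LeftInverse.injective (codeSet_setCode e)

theorem scoreStepCode_eq {F : List ℕ} (hF : F.Sublist (List.range n)) (w : List V) (v : V) :
    scoreStepCode F (score (codeSet e F) w, setCode e (acc (codeSet e F) w)) (e v) =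
      (score (codeSet e F) (w ++ [v]), setCode e (acc (codeSet e F) (w ++ [v]))) := by
  have hnil : setCode e (∅ : Set V) = [] := by simp [setCode]
  have hcond : setCode e (acc (codeSet e F) w) = F.filter (fun x => x ≠ (e v : ℕ)) ↔
      acc (codeSet e F) w = codeSet e F \ {v} := by
    have : F.filter (fun x => x ≠ (e v : ℕ)) = setCode e (codeSet e F \ {v}) := by
      refine eq_of_sublist_range e (List.filter_sublist.trans hF) (setCode_sublist e _) fun u => ?_
      rw [coe_mem_setCode]
      simp [mem_codeSet, Fin.val_inj]
    rw [this]
    exact (setCode_injective e).eq_iff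
  rcases score_concat_cases (codeSet e F) w v with
    ⟨hv, h1, h2⟩ | ⟨hv, ha, h1, h2⟩ | ⟨hv, ha, h1, h2⟩
  · rw [h1, h2, hnil, scoreStepCode, if_pos (show (e v : ℕ) ∉ F from hv)]
  · rw [h1, h2, hnil, scoreStepCode, if_neg (not_not.mpr (show (e v : ℕ) ∈ F from hv)),
      if_pos (hcond.mpr ha)]
  · rw [h1, h2, scoreStepCode, if_neg (not_not.mpr (show (e v : ℕ) ∈ F from hv)),
      if_neg (hcond.not.mpr ha)]
    congr 1
    refine eq_of_sublist_range e (List.filter_sublist.trans hF) (setCode_sublist e _) fun u => ?_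
    rw [coe_mem_setCode]
    simp only [List.mem_filter, coe_mem_setCode, decide_eq_true_eq, Set.mem_union,
      Set.mem_singleton_iff, Fin.val_inj, EmbeddingLike.apply_eq_iff_eq, and_iff_right_iff_imp]
    rintro (h | rfl)
    · exact acc_subset (codeSet e F) w h
    · exact hv

theorem isLoopCode_iff {A : Arena V} {pos0 : List ℕ} {edges : List (ℕ × ℕ)}
    (hA : A.CodedBy e pos0 edges) {F : List ℕ} (hF : F.Sublist (List.range n)) :
    IsLoopCode edges F ↔ A.IsLoop (codeSet e F) := by
  have hex : ∀ x ∈ F, ∃ v ∈ codeSet e F, (e v : ℕ) = x := by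
    intro x hx
    obtain ⟨v, rfl⟩ := exists_eq_of_lt e (List.mem_range.mp (hF.subset hx))
    exact ⟨v, hx, rfl⟩
  constructor
  · rintro ⟨hne, h⟩
    refine ⟨?_, fun v hv v' hv' => ?_⟩
    · obtain ⟨x, hx⟩ := List.exists_mem_of_ne_nil F hne
      obtain ⟨v, hv, -⟩ := hex x hx
      exact ⟨v, hv⟩
    · -- the set of the vertices that are reachable from `v` in `F` is closed
      have hmem : ∀ {u : V}, (e u : ℕ) ∈ F.filter (fun x => ∃ u, (e u : ℕ) = x ∧ Relation.TransGen
          (fun a b => a ∈ codeSet e F ∧ b ∈ codeSet e F ∧ A.Adj a b) v u) ↔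
          u ∈ codeSet e F ∧ Relation.TransGen
          (fun a b => a ∈ codeSet e F ∧ b ∈ codeSet e F ∧ A.Adj a b) v u := by
        intro u
        simp only [List.mem_filter, decide_eq_true_eq, Fin.val_inj, EmbeddingLike.apply_eq_iff_eq,
          exists_eq_left]
        rfl
      refine (hmem.mp (h _ hv _ (List.mem_sublists'.mpr List.filter_sublist) ?_ ?_ _ hv')).2
      · intro x hx hvx
        obtain ⟨u, hu, rfl⟩ := hex x hx
        exact hmem.mpr ⟨hu, .single ⟨hv, hu, (hA.2 _ _).mpr hvx⟩⟩
      · intro y hy x hx hyx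
        obtain ⟨t, ht, rfl⟩ := hex y (List.mem_of_mem_filter hy)
        obtain ⟨u, hu, rfl⟩ := hex x hx
        exact hmem.mpr ⟨hu, (hmem.mp hy).2.tail ⟨ht, hu, (hA.2 _ _).mpr hyx⟩⟩
  · rintro ⟨⟨v₀, hv₀⟩, h⟩
    refine ⟨List.ne_nil_of_mem hv₀, fun x hx S hS hinit hclosed y hy => ?_⟩
    obtain ⟨v, hv, rfl⟩ := hex x hx
    obtain ⟨u, hu, rfl⟩ := hex y hy
    have hvu := h v hv u hu
    clear hy hu
    induction hvu with
    | single h => exact hinit _ h.2.1 ((hA.2 _ _).mp h.2.2)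
    | tail _ h ih => exact hclosed _ ih _ h.2.1 ((hA.2 _ _).mp h.2.2)

end

section

open scoped Classical

variable {V : Type*} {G : MullerGame V} {c : MullerCode} {e : V ≃ Fin c.1}

theorem mem_F1Code (hG : G.CodedBy c e) {F : List ℕ} :
    F ∈ F1Code c ↔ F.Sublist (List.range c.1) ∧ codeSet e F ∈ G.F1 := by
  simp only [F1Code, List.mem_filter, List.mem_sublists', decide_eq_true_eq]
  refine and_congr_right fun hF => and_congr (isLoopCode_iff e hG.1 hF) (not_congr ?_)
  rw [hG.2]
  refine exists_congr fun l => and_congr_right fun _ => ?_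
  rw [Set.ext_iff]
  constructor
  · exact fun h v => h _ (List.mem_range.mpr (e v).2)
  · intro h x hx
    obtain ⟨v, rfl⟩ := exists_eq_of_lt e (List.mem_range.mp hx)
    exact h v

theorem forall_mem_F1Code (hG : G.CodedBy c e) {P : Set V → Prop} :
    (∀ F ∈ F1Code c, P (codeSet e F)) ↔ ∀ F ∈ G.F1, P F := by
  constructor
  · intro h F hF
    rw [← codeSet_setCode e F]
    exact h _ ((mem_F1Code hG).mpr ⟨setCode_sublist e F, by rwa [codeSet_setCode]⟩)
  · exact fun h F hF => h _ ((mem_F1Code hG).mp hF).2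

/-- The state code of a word. -/
noncomputable def wordCode (c : MullerCode) (e : V ≃ Fin c.1) (w : List V) : StateCode :=
  ((w.getLast?.map fun x => (e x : ℕ)).getD 0, (F1Code c).map fun F =>
    (F, score (codeSet e F) w, setCode e (acc (codeSet e F) w)))

theorem wordCode_nil : wordCode c e [] = emptyCode c := by
  simp [wordCode, emptyCode, score_nil, acc_nil, setCode]

theorem wordCode_fst {w : List V} {x : V} (hx : x ∈ w.getLast?) : (wordCode c e w).1 = e x := by
  simp [wordCode, Option.mem_def.mp hx]

theorem stepCode_wordCode (hG : G.CodedBy c e) (w : List V) (v : V) :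
    stepCode (wordCode c e w) (e v) = wordCode c e (w ++ [v]) := by
  refine Prod.ext (by simp [stepCode, wordCode]) ?_
  simp only [stepCode, wordCode, List.map_map]
  refine List.map_congr_left fun F hF => ?_
  simp only [Function.comp_apply]
  rw [scoreStepCode_eq e ((mem_F1Code hG).mp hF).1]

theorem stepCode_emptyCode (hG : G.CodedBy c e) (v : V) :
    stepCode (emptyCode c) (e v) = wordCode c e [v] := by
  rw [← wordCode_nil (e := e), stepCode_wordCode hG, List.nil_append]

theorem wordCode_eq_iff (hG : G.CodedBy c e) {w w' : List V} (hw : w ≠ []) (hw' : w' ≠ []) :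
    wordCode c e w = wordCode c e w' ↔ Equivalent G.F1 w w' := by
  have h1 := List.getLast?_eq_some_getLast hw
  have h2 := List.getLast?_eq_some_getLast hw'
  rw [equivalent_iff, ← forall_mem_F1Code hG, Prod.ext_iff, wordCode_fst h1, wordCode_fst h2]
  refine and_congr ?_ ?_
  · rw [h1, h2, Fin.val_inj, EmbeddingLike.apply_eq_iff_eq, Option.some_inj]
  · simp only [wordCode, List.map_inj_left, Prod.mk.injEq, true_and,
      (setCode_injective e).eq_iff]

theorem isSafeCode_wordCode (hG : G.CodedBy c e) {w : List V} (hw : w ∈ playsLe3 G) :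
    IsSafeCode (wordCode c e w) ↔ w ∈ playsLt3 G := by
  have : IsSafeCode (wordCode c e w) ↔ ∀ F ∈ G.F1, score F w ≤ 2 := by
    rw [← forall_mem_F1Code hG]
    simp [IsSafeCode, wordCode]
  rw [this]
  refine ⟨fun h => hw.elim id ?_, fun h F hF => score_le_two_of_mem_playsLt3 h hF⟩
  rintro ⟨hp, u, v, -, rfl, h2, -⟩
  refine ⟨hp, (enat_lt_three_iff _).mpr ((maxScore_le_iff _ _ _).mpr fun F hF t ht hpre => ?_)⟩
  rcases List.prefix_concat_iff.mp hpre with rfl | hpre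
  · exact h F hF
  · exact (maxScore_le_iff _ _ 2).mp h2 F hF t ht hpre

theorem wordCode_mem_allCodes (hG : G.CodedBy c e) {w : List V} (hw : w ∈ playsLe3 G) :
    wordCode c e w ∈ allCodes c := by
  have hne : w ≠ [] := hw.elim (fun h => h.1.1) fun h => h.1.1
  have hlast := wordCode_fst (c := c) (e := e) (List.getLast?_eq_some_getLast hne)
  simp only [allCodes, List.mem_flatMap, List.mem_map, List.mem_sections]
  refine ⟨(wordCode c e w).1, ?_, (wordCode c e w).2, ?_, rfl⟩
  · rw [hlast, List.mem_range]
    exact (e _).2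
  · rw [wordCode, List.forall₂_map_left_iff, List.forall₂_map_right_iff, List.forall₂_same]
    intro F hF
    obtain ⟨hFr, hF1⟩ := (mem_F1Code hG).mp hF
    have hs := score_le_three_of_mem_playsLe3 hw hF1
    simp only [List.mem_flatMap, List.mem_map, List.mem_range, List.mem_sublists']
    refine ⟨_, Nat.lt_succ_of_le hs, _, ?_, rfl⟩
    have : setCode e (acc (codeSet e F) w) =
        F.filter fun x => x ∈ setCode e (acc (codeSet e F) w) := by
      refine eq_of_sublist_range e (setCode_sublist e _) (List.filter_sublist.trans hFr) fun v => ?_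
      simp only [List.mem_filter, coe_mem_setCode, decide_eq_true_eq]
      exact ⟨fun h => ⟨acc_subset (codeSet e F) w h, h⟩, fun h => h.2⟩
    rw [this]
    exact List.filter_sublist

/-- A play prefix that is continued in the safety game has scores below 3. -/
theorem mem_playsLt3_of_concat {w : List V} {v : V} (h : w ++ [v] ∈ playsLe3 G) (hw : w ≠ []) :
    w ∈ playsLt3 G ∧ ∃ x ∈ w.getLast?, G.arena.Adj x v := by
  have hp : G.arena.IsPlayPrefix (w ++ [v]) := h.elim (fun h => h.1) fun h => h.1
  have hpw : G.arena.IsPlayPrefix w := ⟨hw, (List.isChain_append.mp hp.2).1⟩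
  have hlast := List.getLast?_eq_some_getLast hw
  refine ⟨⟨hpw, ?_⟩, _, hlast, (List.isChain_append.mp hp.2).2.2 _ hlast v (by simp)⟩
  rw [enat_lt_three_iff]
  rcases h with h | ⟨-, u, v', -, he, h2, -⟩
  · rw [maxScore_le_iff]
    exact fun F hF t ht hpre => (maxScore_le_iff _ _ 2).mp ((enat_lt_three_iff _).mp h.2) F hF t ht
      (hpre.trans (List.prefix_append w [v]))
  · rw [(List.append_inj' he rfl).1]
    exact h2

/-- The reachable codes are the codes of play prefixes: these form a closed set, and conversely
every closed set contains the codes of all play prefixes. -/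
theorem mem_reachCodes (hG : G.CodedBy c e) {s : StateCode} :
    s ∈ reachCodes c ↔ ∃ w : playsLe3 G, s = wordCode c e w.1 := by
  simp only [reachCodes, List.mem_filter, decide_eq_true_eq, List.mem_sublists']
  constructor
  · rintro ⟨hs, h⟩
    have hmem : ∀ w : playsLe3 G, wordCode c e w.1 ∈
        (allCodes c).filter fun s => ∃ w : playsLe3 G, s = wordCode c e w.1 := fun w =>
      List.mem_filter.mpr ⟨wordCode_mem_allCodes hG w.2, by simpa using ⟨w.1, w.2, rfl⟩⟩
    have hcl := h ((allCodes c).filter fun s => ∃ w : playsLe3 G, s = wordCode c e w.1)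
      List.filter_sublist ⟨?_, ?_⟩
    · simpa using (List.mem_filter.mp hcl).2
    · intro x hx
      obtain ⟨v, rfl⟩ := exists_eq_of_lt e (List.mem_range.mp hx)
      rw [stepCode_emptyCode hG]
      exact hmem ⟨[v], Or.inl (singleton_mem_playsLt3 G v)⟩
    · intro s hs hsafe x hx hadj
      obtain ⟨w, rfl⟩ : ∃ w : playsLe3 G, s = wordCode c e w.1 := by
        simpa using (List.mem_filter.mp hs).2
      obtain ⟨v, rfl⟩ := exists_eq_of_lt e (List.mem_range.mp hx)
      have hw := (isSafeCode_wordCode hG w.2).mp hsafe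
      have hlast := List.getLast?_eq_some_getLast hw.1.1
      rw [wordCode_fst hlast] at hadj
      rw [stepCode_wordCode hG]
      exact hmem ⟨_, concat_mem_playsLe3 G hw hlast ((hG.1.2 _ _).mpr hadj)⟩
  · rintro ⟨⟨w, hw⟩, rfl⟩
    refine ⟨wordCode_mem_allCodes hG hw, fun S _ hS => ?_⟩
    induction w using List.reverseRecOn with
    | nil => exact absurd rfl (hw.elim (fun h => h.1.1) fun h => h.1.1)
    | append_singleton w v ih =>
      have hv : (e v : ℕ) ∈ List.range c.1 := List.mem_range.mpr (e v).2
      by_cases hne : w = []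
      · subst hne
        change wordCode c e [v] ∈ S
        rw [← stepCode_emptyCode hG]
        exact hS.1 _ hv
      · obtain ⟨hlt, x, hx, hadj⟩ := mem_playsLt3_of_concat hw hne
        have h := hS.2 _ (ih (Or.inl hlt)) ((isSafeCode_wordCode hG (Or.inl hlt)).mpr hlt) _ hv
          (by rw [wordCode_fst hx]; exact (hG.1.2 _ _).mp hadj)
        rwa [stepCode_wordCode hG] at h

theorem mergeCode_wordCode_eq_iff (hG : G.CodedBy c e) {merge : Bool} {w w' : playsLe3 G} :
    mergeCode merge (wordCode c e w.1) = mergeCode merge (wordCode c e w'.1) ↔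
      cls G merge w = cls G merge w' := by
  have hne : ∀ w : playsLe3 G, w.1 ≠ [] := fun w => w.2.elim (fun h => h.1.1) fun h => h.1.1
  have hsafe : ∀ w : playsLe3 G, ¬ IsSafeCode (wordCode c e w.1) ↔ w.1 ∈ playsEq3 G := by
    intro w
    rw [isSafeCode_wordCode hG w.2]
    exact ⟨w.2.resolve_left, fun h h' => notMem_playsEq3 h' h⟩
  have hdead : ¬ IsSafeCode ((0, [([], 3, [])]) : StateCode) := by simp [IsSafeCode]
  have hneq : ∀ {w : playsLe3 G}, w.1 ∉ playsEq3 G → wordCode c e w.1 ≠ (0, [([], 3, [])]) :=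
    fun {w} h h' => h ((hsafe w).mp (h' ▸ hdead))
  have heq := wordCode_eq_iff hG (hne w) (hne w')
  rw [cls_eq_iff, mergeCode, mergeCode]
  simp only [hsafe]
  by_cases hm : merge = true
  · by_cases h : w.1 ∈ playsEq3 G <;> by_cases h' : w'.1 ∈ playsEq3 G
    · simp [hm, h, h']
    · simp only [hm, h, h', and_self, and_false, if_true, if_false, or_false]
      exact ⟨fun he => absurd he.symm (hneq h'),
        fun he => absurd (playsEq3_of_equivalent G h w'.2 he.1) h'⟩
    · simp only [hm, h, h', and_self, and_false, false_and, if_true, if_false, or_false]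
      exact ⟨fun he => absurd he (hneq h),
        fun he => absurd (playsEq3_of_equivalent G h' w.2 he.2) h⟩
    · simpa [hm, h, h'] using heq
  · simpa [hm] using heq

theorem vertexIndex_eq_iff (hG : G.CodedBy c e) {merge : Bool} {w w' : playsLe3 G} :
    vertexIndex merge c (wordCode c e w.1) = vertexIndex merge c (wordCode c e w'.1) ↔
      cls G merge w = cls G merge w' := by
  rw [← mergeCode_wordCode_eq_iff hG]
  refine List.idxOf_inj ?_
  exact List.mem_dedup.mpr (List.mem_map_of_mem ((mem_reachCodes hG).mpr ⟨w, rfl⟩))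

/-- The positions of the codes number the vertices of the safety game. -/
theorem exists_numbering (hG : G.CodedBy c e) (merge : Bool) :
    ∃ e' : SafetyVertex G merge ≃ Fin (vertexCodes merge c).length, ∀ w : playsLe3 G,
      (e' (cls G merge w) : ℕ) = vertexIndex merge c (wordCode c e w.1) := by
  have hlt : ∀ w : playsLe3 G,
      vertexIndex merge c (wordCode c e w.1) < (vertexCodes merge c).length := fun w =>
    List.idxOf_lt_length_iff.mpr
      (List.mem_dedup.mpr (List.mem_map_of_mem ((mem_reachCodes hG).mpr ⟨w, rfl⟩)))
  let f : SafetyVertex G merge → Fin (vertexCodes merge c).length :=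
    Quotient.lift (fun w => ⟨_, hlt w⟩) fun w w' h =>
      Fin.ext ((vertexIndex_eq_iff hG).mpr (Quotient.sound (s := vertexSetoid G merge) h))
  have hf : ∀ w : playsLe3 G,
      (f (cls G merge w) : ℕ) = vertexIndex merge c (wordCode c e w.1) := fun _ => rfl
  refine ⟨Equiv.ofBijective f ⟨fun q q' h => ?_, fun i => ?_⟩, hf⟩
  · obtain ⟨w, rfl⟩ := exists_cls_eq q
    obtain ⟨w', rfl⟩ := exists_cls_eq q'
    refine (vertexIndex_eq_iff hG).mp ?_
    rw [← hf, ← hf, h]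
  · obtain ⟨s, hs, hsi⟩ := List.mem_map.mp (List.mem_dedup.mp (List.getElem_mem i.2))
    obtain ⟨w, rfl⟩ := (mem_reachCodes hG).mp hs
    refine ⟨cls G merge w, Fin.ext ?_⟩
    rw [hf, vertexIndex, hsi]
    exact (List.nodup_dedup _).idxOf_getElem i.1 i.2

theorem mem_filter_reachCodes (hG : G.CodedBy c e) {P : StateCode → Prop} [DecidablePred P]
    {s : StateCode} :
    s ∈ (reachCodes c).filter (fun s => P s) ↔
      ∃ w : playsLe3 G, P (wordCode c e w.1) ∧ s = wordCode c e w.1 := by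
  rw [List.mem_filter, mem_reachCodes hG, decide_eq_true_eq]
  constructor
  · rintro ⟨⟨w, rfl⟩, h⟩
    exact ⟨w, h, rfl⟩
  · rintro ⟨w, h, rfl⟩
    exact ⟨⟨w, rfl⟩, h⟩

/-- The algorithm computes a code of the safety game and of the map `v ↦ [v]`. -/
theorem reduction_correct (hG : G.CodedBy c e) (merge : Bool) :
    ∃ e' : SafetyVertex G merge ≃ Fin (reduction merge c).1.1,
      (safetyGame G merge).CodedBy (reduction merge c).1 e' ∧
      (reduction merge c).2 = List.ofFn fun j => (e' (toSafety G merge (e.symm j)) : ℕ) := by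
  obtain ⟨e', he'⟩ := exists_numbering hG merge
  have hidx : ∀ (w : playsLe3 G) q, vertexIndex merge c (wordCode c e w.1) = e' q ↔
      cls G merge w = q := by
    intro w q
    rw [← he', Fin.val_inj, EmbeddingLike.apply_eq_iff_eq]
  have hlast : ∀ w : playsLe3 G, ∃ x, x ∈ w.1.getLast? := fun w =>
    ⟨_, List.getLast?_eq_some_getLast (w.2.elim (fun h => h.1.1) fun h => h.1.1)⟩
  have hlose : ∀ w : playsLe3 G, ¬ IsSafeCode (wordCode c e w.1) ↔
      cls G merge w ∉ safeVertices G merge := fun w => by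
    rw [isSafeCode_wordCode hG w.2, cls_mem_safeVertices]
  refine ⟨e', ⟨⟨fun q => ?_, fun q q' => ?_⟩, fun q => ?_⟩, ?_⟩
  · simp only [reduction, safetyCode, List.mem_map, mem_filter_reachCodes hG]
    constructor
    · rintro ⟨w, rfl, x, hx, hx0⟩
      exact ⟨_, ⟨w, by rw [wordCode_fst hx]; exact (hG.1.1 x).mp hx0, rfl⟩, (hidx w _).mpr rfl⟩
    · rintro ⟨_, ⟨w, hw, rfl⟩, h⟩
      obtain ⟨x, hx⟩ := hlast w
      rw [wordCode_fst hx] at hw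
      exact ⟨w, (hidx w q).mp h, x, hx, (hG.1.1 x).mpr hw⟩
  · simp only [reduction, safetyCode, List.mem_append, List.mem_flatMap, List.mem_map,
      mem_filter_reachCodes hG, Prod.mk.injEq]
    refine or_congr ⟨?_, ?_⟩ ⟨?_, ?_⟩
    · rintro ⟨w, w', hw, ⟨x, hx, v, hv, hw'⟩, rfl, rfl⟩
      refine ⟨_, ⟨w, (isSafeCode_wordCode hG w.2).mpr hw, rfl⟩, e v, ?_, (hidx w _).mpr rfl, ?_⟩
      · rw [List.mem_filter, List.mem_range, wordCode_fst hx]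
        exact ⟨(e v).2, by simpa using (hG.1.2 _ _).mp hv⟩
      · rw [stepCode_wordCode hG, ← hw']
        exact (hidx w' _).mpr rfl
    · rintro ⟨_, ⟨w, hw, rfl⟩, y, hy, h, h'⟩
      rw [isSafeCode_wordCode hG w.2] at hw
      obtain ⟨x, hx⟩ := hlast w
      rw [List.mem_filter, List.mem_range, wordCode_fst hx, decide_eq_true_eq] at hy
      obtain ⟨v, rfl⟩ := exists_eq_of_lt e hy.1
      have hv := (hG.1.2 x v).mpr hy.2
      rw [stepCode_wordCode hG] at h'
      exact ⟨w, ⟨_, concat_mem_playsLe3 G hw hx hv⟩, hw, ⟨x, hx, v, hv, rfl⟩, (hidx w q).mp h,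
        (hidx ⟨_, concat_mem_playsLe3 G hw hx hv⟩ q').mp h'⟩
    · rintro ⟨hq, rfl⟩
      obtain ⟨w, rfl⟩ := exists_cls_eq q'
      exact ⟨_, ⟨w, (hlose w).mpr hq, rfl⟩, (hidx w _).mpr rfl, (hidx w _).mpr rfl⟩
    · rintro ⟨_, ⟨w, hw, rfl⟩, h, h'⟩
      have h1 := (hidx w q).mp h
      have h2 := (hidx w q').mp h'
      exact ⟨h1 ▸ (hlose w).mp hw, h2.symm.trans h1⟩
  · simp only [reduction, safetyCode, List.mem_map, mem_filter_reachCodes hG]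
    constructor
    · rintro ⟨w, hw, rfl⟩
      exact ⟨_, ⟨w, (isSafeCode_wordCode hG w.2).mpr hw, rfl⟩, (hidx w _).mpr rfl⟩
    · rintro ⟨_, ⟨w, hw, rfl⟩, h⟩
      exact ⟨w, (isSafeCode_wordCode hG w.2).mp hw, (hidx w q).mp h⟩
  · refine List.ext_getElem (by simp [reduction]) fun i h1 h2 => ?_
    have hi : i < c.1 := by simpa using h2
    have hv : stepCode (emptyCode c) i = wordCode c e [e.symm ⟨i, hi⟩] := by
      rw [← stepCode_emptyCode hG]
      simp
    simp only [reduction, List.getElem_map, List.getElem_range, List.getElem_ofFn, toSafety, hv]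
    exact (he' ⟨_, Or.inl (singleton_mem_playsLt3 G _)⟩).symm

end

end MullerGames

theorem mainTheorem1 :
    ∃ Φ : Bool → MullerGames.MullerCode → MullerGames.SafetyCode × List ℕ,
      (∀ merge, Computable (Φ merge)) ∧
      ∀ (V : Type*) [Finite V] (G : MullerGames.MullerGame V),
        (∀ merge : Bool,
          -- the safety game is finite, and `Φ merge` computes it together with the map `v ↦ [v]`
          Finite (MullerGames.SafetyVertex G merge) ∧
          (∀ (c : MullerGames.MullerCode) (e : V ≃ Fin c.1), G.CodedBy c e →
            ∃ e' : MullerGames.SafetyVertex G merge ≃ Fin (Φ merge c).1.1,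
              (MullerGames.safetyGame G merge).CodedBy (Φ merge c).1 e' ∧
              (Φ merge c).2 =
                List.ofFn fun j => (e' (MullerGames.toSafety G merge (e.symm j)) : ℕ)) ∧
          -- winning regions
          (∀ (i : Fin 2) (v : V), v ∈ G.toGame.winRegion i ↔
            MullerGames.toSafety G merge v ∈
              (MullerGames.safetyGame G merge).toGame.winRegion i) ∧
          -- finite-state winning strategy for Player 0
          ((G.toGame.winRegion 0).Nonempty →
            ∃ M : Set (MullerGames.SafetyVertex G merge), M.Finite ∧
              M ⊆ (MullerGames.safetyGame G merge).toGame.winRegion 0 ∧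
              ∃ (𝔐 : MullerGames.MemoryStructure V M)
                (nxt : MullerGames.NextMove G.toGame.arena 0 M),
                G.toGame.IsWinningFrom (nxt.strategy 𝔐) (G.toGame.winRegion 0))) ∧
        -- size
        Nat.card (MullerGames.SafetyVertex G true) ≤
          (∑ k ∈ Finset.Icc 1 (Nat.card V), (Nat.card V).choose k * k.factorial * 2 ^ k *
            k.factorial) + 1 ∧
        (4 ≤ Nat.card V →
          (∑ k ∈ Finset.Icc 1 (Nat.card V), (Nat.card V).choose k * k.factorial * 2 ^ k *
            k.factorial) + 1 ≤ (Nat.card V).factorial ^ 3) := by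
  refine ⟨MullerGames.reduction, fun merge => (MullerGames.primrec_reduction merge).to_comp,
    fun V _ G => ⟨fun merge => ⟨inferInstance, fun c e hG => MullerGames.reduction_correct hG merge,
      MullerGames.mem_winRegion_iff G merge, fun ⟨v, hv⟩ => ?_⟩,
      MullerGames.card_safetyVertex_le G, MullerGames.sum_add_one_le_factorial_pow⟩⟩
  obtain ⟨𝔐, nxt, hwin⟩ := MullerGames.exists_finiteState_strategy G merge
    (MullerGames.safetyGame G merge).isSafeTrap_winRegion.1
    ⟨_, (MullerGames.mem_winRegion_zero_iff G merge v).mp hv⟩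
  exact ⟨_, Set.toFinite _, subset_rfl, 𝔐, nxt, fun u hu =>
    hwin u ((MullerGames.mem_winRegion_zero_iff G merge u).mp hu)⟩
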